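/- A quantum space (abstract operator space) is a complex linear space $E$, not necessarily complete, with a norm on each matrix space $M_m(E)$, $m\in\mathbb N$, satisfying Ruan's axioms: $\|v\oplus w\|=\max(\|v\|,\|w\|)$ and $\|\alpha v\beta\|\le\|\alpha\|\,\|v\|\,\|\beta\|$ for scalar matrices $\alpha,\beta$ with their operator norms. For a linear map $\varphi:F\to E$ between quantum spaces let $\varphi_m:M_m(F)\to M_m(E)$ be its entrywise application; $\varphi$ is completely bounded if each $\varphi_m$ is bounded and $\|\varphi\|_{cb}:=\sup_m\|\varphi_m\|<\infty$, and it is a completely isometric isomorphism if every $\varphi_m$ is an isometric isomorphism. The space $\mathcal{CB}(F,E)$ of completely bounded operators is a quantum space via $M_k(\mathcal{CB}(F,E))=\mathcal{CB}(F,M_k(E))$ with the norm $\|\cdot\|_{cb}$, and $M_n(E)$ is a quantum space via $M_m(M_n(E))=M_{mn}(E)$. The quantum space $M_n=M_n(\mathbb C)$ is $\mathcal B(\mathbb C^n)$, where $M_m(M_n)=M_{mn}(\mathbb C)$ carries the operator norm. Let $\mathcal N_n$ be the space of trace-class operators on $\mathbb C^n$ with the quantum norm induced from the quantum dual $\mathcal{CB}(M_n,\mathbb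 C)$ of $M_n$ by the identification $b\mapsto(a\mapsto\mathrm{tr}(ba))$. **Proposition 5.4.** Let $n\in\mathbb N$. For every quantum space $E$ there is a completely isometric isomorphism $$\iota_n^E:M_n(E)\to\mathcal{CB}(\mathcal N_n,E),$$ which is the unique linear map taking each elementary tensor $a\otimes x=(a_{kl}x)_{k,l}\in M_n\otimes E=M_n(E)$ to the operator $b\mapsto\mathrm{tr}(ab)\,x$ ($a\in M_n$, $b\in\mathcal N_n$, $x\in E$). Moreover, $\iota_n^E$ is natural in $E$: for every completely bounded operator $\varphi:G\to E$ between quantum spaces and every $v\in M_n(G)$, $$\iota_n^E(\varphi_n(v))=\varphi\circ\iota_n^G(v).$$ -/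

import Mathlib

namespace Quantum

open Matrix

noncomputable section

universe u v w

set_option linter.unusedSectionVars false

/-! ### Scalar matrices and their operator norms -/

section Scalar

variable {ι κ μ : Type*} [Fintype ι] [Fintype κ] [Fintype μ]
  [DecidableEq ι] [DecidableEq κ] [DecidableEq μ]

/-- The operator norm of a rectangular complex matrix, seen as an operator between the Hilbert
spaces `ℂ^ι` and `ℂ^κ`. -/
def opNorm (α : Matrix κ ι ℂ) : ℝ :=
  ‖LinearMap.toContinuousLinearMap (Matrix.toEuclideanLin α)‖

open scoped Matrix.Norms.L2Operator in
theorem opNorm_eq (α : Matrix κ ι ℂ) : opNorm α = ‖α‖ := rfl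

theorem opNorm_nonneg (α : Matrix κ ι ℂ) : 0 ≤ opNorm α := norm_nonneg _

theorem opNorm_mul_le (α : Matrix κ ι ℂ) (β : Matrix ι μ ℂ) :
    opNorm (α * β) ≤ opNorm α * opNorm β := by
  simp only [opNorm_eq]
  exact Matrix.l2_opNorm_mul α β

theorem opNorm_le {α : Matrix κ ι ℂ} {C : ℝ} (hC : 0 ≤ C)
    (h : ∀ x : ι → ℂ, ∑ i, ‖(α *ᵥ x) i‖ ^ 2 ≤ C ^ 2 * ∑ j, ‖x j‖ ^ 2) : opNorm α ≤ C := by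
  refine ContinuousLinearMap.opNorm_le_bound _ hC fun x => ?_
  refine (sq_le_sq₀ (norm_nonneg _) (by positivity)).mp ?_
  rw [mul_pow, EuclideanSpace.norm_sq_eq, EuclideanSpace.norm_sq_eq]
  exact h x.ofLp

theorem sum_sq_le (α : Matrix κ ι ℂ) (x : ι → ℂ) :
    ∑ i, ‖(α *ᵥ x) i‖ ^ 2 ≤ opNorm α ^ 2 * ∑ j, ‖x j‖ ^ 2 := by
  have h := (LinearMap.toContinuousLinearMap (Matrix.toEuclideanLin α)).le_opNorm
    (WithLp.toLp 2 x)
  have h2 := (sq_le_sq₀ (norm_nonneg _) (by positivity)).mpr h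
  rw [mul_pow, EuclideanSpace.norm_sq_eq, EuclideanSpace.norm_sq_eq] at h2
  exact h2

/-- The zero-one matrix of a map between index sets. -/
def pick (f : κ → ι) : Matrix κ ι ℂ := Matrix.of fun p i => if f p = i then 1 else 0

theorem opNorm_one_le : opNorm (1 : Matrix ι ι ℂ) ≤ 1 :=
  opNorm_le zero_le_one fun x => by simp

theorem opNorm_pick_transpose_le {f : κ → ι} (hf : Function.Injective f) :
    opNorm (pick f)ᵀ ≤ 1 := by
  have hT : (pick f)ᵀ = (pick f)ᴴ := by
    ext i p; simp [pick]
  have h1 : (pick f)ᵀᴴ * (pick f)ᵀ = 1 := by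
    ext p q
    simp [pick, Matrix.mul_apply, Matrix.one_apply, hf.eq_iff, eq_comm]
  have h2 : opNorm (pick f)ᵀ * opNorm (pick f)ᵀ ≤ 1 := by
    have := Matrix.l2_opNorm_conjTranspose_mul_self (pick f)ᵀ
    rw [h1] at this
    exact this ▸ opNorm_one_le
  nlinarith [opNorm_nonneg (pick f)ᵀ]

theorem opNorm_pick_le {f : κ → ι} (hf : Function.Injective f) : opNorm (pick f) ≤ 1 := by
  have hT : (pick f) = (pick f)ᵀᴴ := by
    ext i p; simp [pick]
  rw [hT, opNorm_eq, Matrix.l2_opNorm_conjTranspose]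
  exact opNorm_pick_transpose_le hf

theorem submatrix_eq (α : Matrix κ ι ℂ) {κ' ι' : Type*} [Fintype κ'] [Fintype ι'] [DecidableEq κ']
    [DecidableEq ι'] (f : κ' → κ) (g : ι' → ι) :
    α.submatrix f g = pick f * α * (pick g)ᵀ := by
  ext p q
  simp [pick, Matrix.mul_apply]

theorem opNorm_submatrix_le (α : Matrix κ ι ℂ) {κ' ι' : Type*} [Fintype κ'] [Fintype ι']
    [DecidableEq κ'] [DecidableEq ι'] {f : κ' → κ} {g : ι' → ι}
    (hf : Function.Injective f) (hg : Function.Injective g) :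
    opNorm (α.submatrix f g) ≤ opNorm α := by
  rw [submatrix_eq]
  have h1 := opNorm_mul_le (pick f * α) (pick g)ᵀ
  have h2 := opNorm_mul_le (pick f) α
  have h3 := opNorm_pick_le hf
  have h4 := opNorm_pick_transpose_le hg
  have := opNorm_nonneg α
  have := opNorm_nonneg (pick f * α)
  have := opNorm_nonneg (pick f)
  have := opNorm_nonneg (pick g)ᵀ
  nlinarith

theorem opNorm_tensor_one_le (α : Matrix κ ι ℂ) :
    opNorm (Matrix.of fun (p : κ × μ) (q : ι × μ) => if p.2 = q.2 then α p.1 q.1 else 0)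
      ≤ opNorm α := by
  refine opNorm_le (opNorm_nonneg α) fun x => ?_
  rw [Fintype.sum_prod_type_right, Fintype.sum_prod_type_right, Finset.mul_sum]
  refine Finset.sum_le_sum fun m _ => ?_
  refine le_trans (le_of_eq ?_) (sum_sq_le α fun i => x (i, m))
  refine Finset.sum_congr rfl fun p _ => ?_
  simp [Matrix.mulVec, dotProduct, Fintype.sum_prod_type]

theorem opNorm_one_tensor_le (α : Matrix κ ι ℂ) :
    opNorm (Matrix.of fun (p : μ × κ) (q : μ × ι) => if p.1 = q.1 then α p.2 q.2 else 0)
      ≤ opNorm α := by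
  refine opNorm_le (opNorm_nonneg α) fun x => ?_
  rw [Fintype.sum_prod_type, Fintype.sum_prod_type, Finset.mul_sum]
  refine Finset.sum_le_sum fun m _ => ?_
  refine le_trans (le_of_eq ?_) (sum_sq_le α fun i => x (m, i))
  refine Finset.sum_congr rfl fun p _ => ?_
  simp [Matrix.mulVec, dotProduct, Fintype.sum_prod_type_right]

theorem opNorm_fromBlocks (α : Matrix ι ι ℂ) (β : Matrix κ κ ℂ) :
    opNorm (Matrix.fromBlocks α 0 0 β) = max (opNorm α) (opNorm β) := by
  apply le_antisymm
  · refine opNorm_le (le_max_of_le_left (opNorm_nonneg α)) fun x => ?_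
    rw [Fintype.sum_sum_type, Fintype.sum_sum_type, mul_add]
    have ha := sum_sq_le α (x ∘ Sum.inl)
    have hb := sum_sq_le β (x ∘ Sum.inr)
    simp only [Matrix.fromBlocks_mulVec, Sum.elim_inl, Sum.elim_inr, Matrix.zero_mulVec, add_zero,
      zero_add]
    refine add_le_add (ha.trans ?_) (hb.trans ?_)
    · refine mul_le_mul_of_nonneg_right ?_ (Finset.sum_nonneg fun _ _ => by positivity)
      exact pow_le_pow_left₀ (opNorm_nonneg _) (le_max_left _ _) 2
    · refine mul_le_mul_of_nonneg_right ?_ (Finset.sum_nonneg fun _ _ => by positivity)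
      exact pow_le_pow_left₀ (opNorm_nonneg _) (le_max_right _ _) 2
  · refine max_le ?_ ?_
    · have h := opNorm_submatrix_le (Matrix.fromBlocks α 0 0 β) (f := Sum.inl) (g := Sum.inl)
        Sum.inl_injective Sum.inl_injective
      have h0 : (Matrix.fromBlocks α 0 0 β).submatrix Sum.inl Sum.inl = α := by
        ext i j
        simp
      rwa [h0] at h
    · have h := opNorm_submatrix_le (Matrix.fromBlocks α 0 0 β) (f := Sum.inr) (g := Sum.inr)
        Sum.inr_injective Sum.inr_injective
      have h0 : (Matrix.fromBlocks α 0 0 β).submatrix Sum.inr Sum.inr = β := by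
        ext i j
        simp
      rwa [h0] at h

end Scalar

/-! ### Quantum spaces -/

/-- The product `α v β` of a matrix `v` with entries in a complex linear space and of scalar
matrices `α`, `β`. -/
def lrMul {E : Type*} [AddCommGroup E] [Module ℂ E] {ι κ : Type*} [Fintype ι]
    (α : Matrix κ ι ℂ) (v : Matrix ι ι E) (β : Matrix ι κ ℂ) : Matrix κ κ E :=
  Matrix.of fun p q => ∑ i, ∑ j, (α p i * β j q) • v i j

/-- The block-diagonal matrix `v ⊕ w` in `M_{m+n}(E)`. -/
def directSum {E : Type*} [AddCommGroup E] {m n : ℕ}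
    (v : Matrix (Fin m) (Fin m) E) (w : Matrix (Fin n) (Fin n) E) :
    Matrix (Fin (m + n)) (Fin (m + n)) E :=
  (Matrix.fromBlocks v 0 0 w).submatrix finSumFinEquiv.symm finSumFinEquiv.symm

/-- A quantum space (abstract operator space): a complex linear space `E` with a norm on each
`M_n(E)`, such that the two axioms of Ruan are satisfied. The space is not assumed to be complete.
(The level `n = 0` carries no information, since `M_0(E) = 0`. Nonnegativity of the norms follows
from the triangle inequality and homogeneity.) -/
class QuantumSpace (E : Type u) [AddCommGroup E] [Module ℂ E] where
  /-- The norm on `M_n(E)`. -/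
  qnorm : ∀ n : ℕ, Matrix (Fin n) (Fin n) E → ℝ
  qnorm_add_le : ∀ (n : ℕ) (v w : Matrix (Fin n) (Fin n) E),
    qnorm n (v + w) ≤ qnorm n v + qnorm n w
  qnorm_smul : ∀ (n : ℕ) (c : ℂ) (v : Matrix (Fin n) (Fin n) E),
    qnorm n (c • v) = ‖c‖ * qnorm n v
  eq_zero_of_qnorm : ∀ (n : ℕ) (v : Matrix (Fin n) (Fin n) E), qnorm n v = 0 → v = 0
  qnorm_directSum : ∀ (m n : ℕ) (v : Matrix (Fin m) (Fin m) E) (w : Matrix (Fin n) (Fin n) E),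
    qnorm (m + n) (directSum v w) = max (qnorm m v) (qnorm n w)
  qnorm_lrMul_le : ∀ (m n : ℕ) (α : Matrix (Fin n) (Fin m) ℂ) (v : Matrix (Fin m) (Fin m) E)
    (β : Matrix (Fin m) (Fin n) ℂ),
    qnorm n (lrMul α v β) ≤ opNorm α * qnorm m v * opNorm β

open QuantumSpace

section General

variable {E : Type*} [AddCommGroup E] [Module ℂ E] [QuantumSpace E]

theorem qnorm_zero (n : ℕ) : qnorm n (0 : Matrix (Fin n) (Fin n) E) = 0 := by
  simpa using qnorm_smul n 0 (0 : Matrix (Fin n) (Fin n) E)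

theorem qnorm_nonneg {n : ℕ} (v : Matrix (Fin n) (Fin n) E) : 0 ≤ qnorm n v := by
  have h1 := qnorm_add_le n v ((-1 : ℂ) • v)
  have h2 := qnorm_smul n (-1 : ℂ) v
  have h3 : v + (-1 : ℂ) • v = 0 := by simp
  rw [h3, qnorm_zero, h2] at h1
  simp at h1
  linarith

variable {ι κ : Type*} [Fintype ι] [Fintype κ] [DecidableEq ι] [DecidableEq κ]

theorem lrMul_pick (v : Matrix ι ι E) (f g : κ → ι) :
    lrMul (pick f) v (pick g)ᵀ = v.submatrix f g := by
  ext p q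
  simp [lrMul, pick]

theorem qnorm_submatrix_le {m n : ℕ} (v : Matrix (Fin m) (Fin m) E) {f g : Fin n → Fin m}
    (hf : Function.Injective f) (hg : Function.Injective g) :
    qnorm n (v.submatrix f g) ≤ qnorm m v := by
  rw [← lrMul_pick]
  have h1 := qnorm_lrMul_le m n (pick f) v (pick g)ᵀ
  have h3 := opNorm_pick_le hf
  have h4 := opNorm_pick_transpose_le hg
  have := opNorm_nonneg (pick f)
  have := opNorm_nonneg (pick g)ᵀ
  have := qnorm_nonneg v
  have h5 : opNorm (pick f) * qnorm m v ≤ qnorm m v := by nlinarith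
  have h6 : 0 ≤ opNorm (pick f) * qnorm m v := by positivity
  nlinarith

/-- The norm of a matrix indexed by an arbitrary finite set, through an enumeration of this set;
it does not depend on the enumeration. -/
def gnorm (v : Matrix ι ι E) : ℝ :=
  qnorm (Fintype.card ι) (v.submatrix (Fintype.equivFin ι).symm (Fintype.equivFin ι).symm)

theorem qnorm_reindex {n : ℕ} (e : Fin n ≃ ι) (v : Matrix ι ι E) :
    qnorm n (v.submatrix e e) = gnorm v := by
  apply le_antisymm
  · have := qnorm_submatrix_le (v.submatrix (Fintype.equivFin ι).symm (Fintype.equivFin ι).symm)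
      (e.trans (Fintype.equivFin ι)).injective (e.trans (Fintype.equivFin ι)).injective
    refine le_trans (le_of_eq (congrArg _ ?_)) this
    ext i j
    simp
  · have := qnorm_submatrix_le (v.submatrix e e)
      ((Fintype.equivFin ι).symm.trans e.symm).injective
      ((Fintype.equivFin ι).symm.trans e.symm).injective
    rw [gnorm]
    refine le_trans (le_of_eq (congrArg _ ?_)) this
    ext i j
    simp

theorem gnorm_fin {n : ℕ} (v : Matrix (Fin n) (Fin n) E) : gnorm v = qnorm n v :=
  (qnorm_reindex (Equiv.refl _) v).symm

theorem gnorm_nonneg (v : Matrix ι ι E) : 0 ≤ gnorm v := qnorm_nonneg _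

theorem gnorm_add_le (v w : Matrix ι ι E) : gnorm (v + w) ≤ gnorm v + gnorm w :=
  qnorm_add_le _ _ _

theorem gnorm_smul (c : ℂ) (v : Matrix ι ι E) : gnorm (c • v) = ‖c‖ * gnorm v :=
  qnorm_smul _ _ _

theorem eq_zero_of_gnorm {v : Matrix ι ι E} (h : gnorm v = 0) : v = 0 := by
  have := eq_zero_of_qnorm _ _ h
  ext i j
  have h2 := congrFun (congrFun this (Fintype.equivFin ι i)) (Fintype.equivFin ι j)
  simpa using h2

theorem gnorm_lrMul_le (α : Matrix κ ι ℂ) (v : Matrix ι ι E) (β : Matrix ι κ ℂ) :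
    gnorm (lrMul α v β) ≤ opNorm α * gnorm v * opNorm β := by
  set e := (Fintype.equivFin ι).symm
  set f := (Fintype.equivFin κ).symm
  have h := qnorm_lrMul_le _ _ (α.submatrix f e) (v.submatrix e e) (β.submatrix e f)
  have h0 : lrMul (α.submatrix f e) (v.submatrix e e) (β.submatrix e f)
      = (lrMul α v β).submatrix f f := by
    ext p q
    simp only [lrMul, Matrix.submatrix_apply, Matrix.of_apply]
    rw [Equiv.sum_comp e (fun i => ∑ j, (α (f p) i * β (e j) (f q)) • v i (e j))]
    refine Finset.sum_congr rfl fun i _ => ?_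
    exact Equiv.sum_comp e (fun j => (α (f p) i * β j (f q)) • v i j)
  rw [h0, qnorm_reindex, qnorm_reindex] at h
  refine h.trans ?_
  have h1 := opNorm_submatrix_le α f.injective e.injective
  have h2 := opNorm_submatrix_le β e.injective f.injective
  have := opNorm_nonneg α
  have := opNorm_nonneg (β.submatrix e f)
  have := gnorm_nonneg v
  gcongr

theorem gnorm_le_of_contr {α : Matrix κ ι ℂ} {β : Matrix ι κ ℂ} (hα : opNorm α ≤ 1)
    (hβ : opNorm β ≤ 1) (v : Matrix ι ι E) : gnorm (lrMul α v β) ≤ gnorm v := by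
  refine (gnorm_lrMul_le α v β).trans ?_
  have := opNorm_nonneg α
  have := opNorm_nonneg β
  have := gnorm_nonneg v
  calc opNorm α * gnorm v * opNorm β ≤ 1 * gnorm v * 1 := by gcongr
    _ = gnorm v := by ring

theorem gnorm_submatrix_le (v : Matrix ι ι E) {f g : κ → ι}
    (hf : Function.Injective f) (hg : Function.Injective g) :
    gnorm (v.submatrix f g) ≤ gnorm v := by
  rw [← lrMul_pick]
  exact gnorm_le_of_contr (opNorm_pick_le hf) (opNorm_pick_transpose_le hg) v

theorem gnorm_submatrix_equiv (v : Matrix ι ι E) (e : κ ≃ ι) :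
    gnorm (v.submatrix e e) = gnorm v := by
  refine le_antisymm (gnorm_submatrix_le v e.injective e.injective) ?_
  have := gnorm_submatrix_le (v.submatrix e e) e.symm.injective e.symm.injective
  simpa using this

theorem gnorm_fromBlocks (v : Matrix ι ι E) (w : Matrix κ κ E) :
    gnorm (Matrix.fromBlocks v 0 0 w) = max (gnorm v) (gnorm w) := by
  set e := (Fintype.equivFin ι).symm
  set f := (Fintype.equivFin κ).symm
  have h := qnorm_directSum _ _ (v.submatrix e e) (w.submatrix f f)
  have h0 : directSum (v.submatrix e e) (w.submatrix f f)
      = (Matrix.fromBlocks v 0 0 w).submatrix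
        (finSumFinEquiv.symm.trans (Equiv.sumCongr e f))
        (finSumFinEquiv.symm.trans (Equiv.sumCongr e f)) := by
    ext p q
    simp only [directSum, Matrix.submatrix_apply, Equiv.trans_apply]
    rcases finSumFinEquiv.symm p with i | i <;> rcases finSumFinEquiv.symm q with j | j <;> simp
  rw [h0, qnorm_reindex, qnorm_reindex, qnorm_reindex] at h
  exact h

theorem gnorm_embed_le (v : Matrix ι ι E) {f g : ι → κ}
    (hf : Function.Injective f) (hg : Function.Injective g) :
    gnorm (lrMul (pick f)ᵀ v (pick g)) ≤ gnorm v :=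
  gnorm_le_of_contr (opNorm_pick_transpose_le hf) (opNorm_pick_le hg) v

end General

/-- The complex numbers as a quantum space: `M_n(ℂ)` carries the operator norm of `B(ℂ^n)`. -/
instance instQuantumSpaceComplex : QuantumSpace ℂ where
  qnorm _ v := opNorm v
  qnorm_add_le n v w := by
    simp only [opNorm, map_add]
    exact norm_add_le _ _
  qnorm_smul n c v := by
    simp only [opNorm, map_smul]
    exact norm_smul _ _
  eq_zero_of_qnorm n v h := by
    simpa [opNorm] using h
  qnorm_directSum m n v w := by
    rw [← opNorm_fromBlocks]
    refine le_antisymm (opNorm_submatrix_le _ (Equiv.injective _) (Equiv.injective _)) ?_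
    have := opNorm_submatrix_le (directSum v w) finSumFinEquiv.injective finSumFinEquiv.injective
    simpa [directSum] using this
  qnorm_lrMul_le m n α v β := by
    have h : lrMul α v β = α * v * β := by
      ext p q
      simp only [lrMul, Matrix.of_apply, Matrix.mul_apply, Finset.sum_mul, smul_eq_mul]
      rw [Finset.sum_comm]
      exact Finset.sum_congr rfl fun i _ => Finset.sum_congr rfl fun j _ => by ring
    rw [h]
    refine (opNorm_mul_le _ _).trans ?_
    exact mul_le_mul_of_nonneg_right (opNorm_mul_le _ _) (opNorm_nonneg _)

/-- `M_n(E)` is a quantum space, with `M_m(M_n(E))` identified with `M_{mn}(E)`. -/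
instance instQuantumSpaceMatrix {E : Type u} [AddCommGroup E] [Module ℂ E] [QuantumSpace E]
    (n : ℕ) : QuantumSpace (Matrix (Fin n) (Fin n) E) where
  qnorm m v := qnorm (m * n)
    ((Matrix.comp _ _ _ _ E v).submatrix finProdFinEquiv.symm finProdFinEquiv.symm)
  qnorm_add_le m v w := qnorm_add_le _ _ _
  qnorm_smul m c v := qnorm_smul _ _ _
  eq_zero_of_qnorm m v h := by
    rw [qnorm_reindex] at h
    have h2 := eq_zero_of_gnorm h
    ext i j k l
    exact congrFun (congrFun h2 (i, k)) (j, l)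
  qnorm_directSum m k v w := by
    simp only [qnorm_reindex]
    rw [← gnorm_fromBlocks]
    rw [← gnorm_submatrix_equiv (Matrix.fromBlocks _ _ _ _)
      ((Equiv.prodCongr finSumFinEquiv.symm (Equiv.refl (Fin n))).trans
        (Equiv.sumProdDistrib (Fin m) (Fin k) (Fin n)))]
    congr 1
    ext ⟨p, i⟩ ⟨q, j⟩
    simp only [directSum, Matrix.comp_apply, Matrix.submatrix_apply, Equiv.trans_apply,
      Equiv.prodCongr_apply, Prod.map_apply, Equiv.refl_apply]
    rcases finSumFinEquiv.symm p with a | a <;> rcases finSumFinEquiv.symm q with b | b <;> simp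
  qnorm_lrMul_le m k α v β := by
    simp only [qnorm_reindex]
    have h0 : Matrix.comp _ _ _ _ E (lrMul α v β) = lrMul
        (Matrix.of fun (p : Fin k × Fin n) (q : Fin m × Fin n) =>
          if p.2 = q.2 then α p.1 q.1 else 0) (Matrix.comp _ _ _ _ E v)
        (Matrix.of fun (p : Fin m × Fin n) (q : Fin k × Fin n) =>
          if p.2 = q.2 then β p.1 q.1 else 0) := by
      ext ⟨p, i⟩ ⟨q, j⟩
      simp [lrMul, Matrix.comp_apply, Matrix.sum_apply, Fintype.sum_prod_type]
    rw [h0]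
    refine (gnorm_lrMul_le _ _ _).trans ?_
    have h1 := opNorm_tensor_one_le (μ := Fin n) α
    have h2 := opNorm_tensor_one_le (μ := Fin n) β
    have h3 := gnorm_nonneg (Matrix.comp _ _ _ _ E v)
    have h4 := opNorm_nonneg α
    refine mul_le_mul (mul_le_mul_of_nonneg_right h1 h3) h2 (opNorm_nonneg _) (by positivity)

/-- The quantum norm induced by an injective linear map into a quantum space. -/
@[reducible] def QuantumSpace.induced {E : Type u} {F : Type v} [AddCommGroup E] [Module ℂ E]
    [AddCommGroup F] [Module ℂ F] [QuantumSpace F] (f : E →ₗ[ℂ] F)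
    (hf : Function.Injective f) : QuantumSpace E where
  qnorm n v := qnorm n (v.map f)
  qnorm_add_le n v w := by
    rw [Matrix.map_add f (map_add f)]
    exact qnorm_add_le _ _ _
  qnorm_smul n c v := by
    rw [Matrix.map_smul f c (map_smul f c)]
    exact qnorm_smul _ _ _
  eq_zero_of_qnorm n v h := by
    have h2 := eq_zero_of_qnorm _ _ h
    ext i j
    apply hf
    simpa using congrFun (congrFun h2 i) j
  qnorm_directSum m n v w := by
    rw [← qnorm_directSum]
    congr 1
    ext p q
    simp only [directSum, Matrix.map_apply, Matrix.submatrix_apply]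
    rcases finSumFinEquiv.symm p with i | i <;> rcases finSumFinEquiv.symm q with j | j <;> simp
  qnorm_lrMul_le m n α v β := by
    refine le_trans (le_of_eq ?_) (qnorm_lrMul_le m n α (v.map f) β)
    congr 1
    ext p q
    simp [lrMul]

/-! ### Completely bounded operators -/

section CB

variable {F : Type u} {E : Type v} {G : Type w} [AddCommGroup F] [Module ℂ F] [QuantumSpace F]
  [AddCommGroup E] [Module ℂ E] [QuantumSpace E] [AddCommGroup G] [Module ℂ G] [QuantumSpace G]

/-- The amplification `φ_n : M_n(F) → M_n(E)`, applying `φ` to every entry. -/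
def amp (n : ℕ) {F : Type u} {E : Type v} [AddCommGroup F] [Module ℂ F] [AddCommGroup E]
    [Module ℂ E] (φ : F →ₗ[ℂ] E) :
    Matrix (Fin n) (Fin n) F →ₗ[ℂ] Matrix (Fin n) (Fin n) E :=
  φ.mapMatrix

/-- `‖φ_n v‖ ≤ C ‖v‖` for all `n` and all `v` in `M_n(F)`, for some constant `C`; that is, the
amplifications are bounded operators with `sup_n ‖φ_n‖ < ∞`. -/
def IsCompletelyBounded (φ : F →ₗ[ℂ] E) : Prop :=
  ∃ C : ℝ, ∀ (n : ℕ) (v : Matrix (Fin n) (Fin n) F), qnorm n (amp n φ v) ≤ C * qnorm n v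

/-- The operator norm of the amplification `φ_n`. -/
def ampNorm (n : ℕ) (φ : F →ₗ[ℂ] E) : ℝ :=
  sInf {C : ℝ | 0 ≤ C ∧ ∀ v : Matrix (Fin n) (Fin n) F, qnorm n (amp n φ v) ≤ C * qnorm n v}

/-- The completely bounded norm `sup_n ‖φ_n‖` (meaningful for completely bounded `φ`). -/
def cbNorm (φ : F →ₗ[ℂ] E) : ℝ := ⨆ n : ℕ, ampNorm n φ

theorem cbNorm_le {φ : F →ₗ[ℂ] E} {C : ℝ} (hC : 0 ≤ C)
    (h : ∀ (n : ℕ) (v : Matrix (Fin n) (Fin n) F), qnorm n (amp n φ v) ≤ C * qnorm n v) :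
    cbNorm φ ≤ C :=
  ciSup_le fun n => csInf_le ⟨0, fun _ hx => hx.1⟩ ⟨hC, h n⟩

theorem IsCompletelyBounded.exists_nonneg {φ : F →ₗ[ℂ] E} (h : IsCompletelyBounded φ) :
    ∃ C : ℝ, 0 ≤ C ∧
      ∀ (n : ℕ) (v : Matrix (Fin n) (Fin n) F), qnorm n (amp n φ v) ≤ C * qnorm n v := by
  obtain ⟨C, hC⟩ := h
  refine ⟨max C 0, le_max_right _ _, fun n v => (hC n v).trans ?_⟩
  exact mul_le_mul_of_nonneg_right (le_max_left _ _) (qnorm_nonneg v)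

theorem ampNorm_nonneg (n : ℕ) (φ : F →ₗ[ℂ] E) : 0 ≤ ampNorm n φ :=
  Real.sInf_nonneg fun _ hx => hx.1

theorem cbNorm_nonneg (φ : F →ₗ[ℂ] E) : 0 ≤ cbNorm φ :=
  Real.iSup_nonneg fun n => ampNorm_nonneg n φ

theorem le_cbNorm {φ : F →ₗ[ℂ] E} (h : IsCompletelyBounded φ) (n : ℕ)
    (v : Matrix (Fin n) (Fin n) F) : qnorm n (amp n φ v) ≤ cbNorm φ * qnorm n v := by
  obtain ⟨C, hC, hb⟩ := h.exists_nonneg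
  have hbdd : BddAbove (Set.range fun n : ℕ => ampNorm n φ) :=
    ⟨C, by rintro _ ⟨k, rfl⟩; exact csInf_le ⟨0, fun _ hx => hx.1⟩ ⟨hC, hb k⟩⟩
  have h1 : ampNorm n φ ≤ cbNorm φ := le_ciSup hbdd n
  refine le_trans ?_ (mul_le_mul_of_nonneg_right h1 (qnorm_nonneg v))
  rcases (qnorm_nonneg v).eq_or_lt with h0 | h0
  · have := hb n v
    rw [← h0, mul_zero] at this ⊢
    exact this
  · rw [← div_le_iff₀ h0]
    refine le_csInf ⟨C, hC, hb n⟩ fun D hD => ?_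
    rw [div_le_iff₀ h0]
    exact hD.2 v

theorem IsCompletelyBounded.comp {φ : F →ₗ[ℂ] E} {ψ : G →ₗ[ℂ] F} (hφ : IsCompletelyBounded φ)
    (hψ : IsCompletelyBounded ψ) : IsCompletelyBounded (φ ∘ₗ ψ) := by
  obtain ⟨C, hC, h1⟩ := hφ.exists_nonneg
  obtain ⟨D, h2⟩ := hψ
  refine ⟨C * D, fun n v => (h1 n (amp n ψ v)).trans ?_⟩
  rw [mul_assoc]
  exact mul_le_mul_of_nonneg_left (h2 n v) hC

variable (F E) in
/-- The linear space `CB(F, E)` of completely bounded operators. -/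
def CB : Submodule ℂ (F →ₗ[ℂ] E) where
  carrier := {φ | IsCompletelyBounded φ}
  zero_mem' := ⟨0, fun n v => by
    have : amp n (0 : F →ₗ[ℂ] E) v = 0 := by ext i j; simp [amp]
    rw [this, qnorm_zero, zero_mul]⟩
  add_mem' := by
    rintro φ ψ ⟨C, hC⟩ ⟨D, hD⟩
    refine ⟨C + D, fun n v => ?_⟩
    rw [add_mul]
    exact (qnorm_add_le n (amp n φ v) (amp n ψ v)).trans (add_le_add (hC n v) (hD n v))
  smul_mem' := by
    rintro c φ ⟨C, hC⟩
    refine ⟨‖c‖ * C, fun n v => ?_⟩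
    have : amp n (c • φ) v = c • amp n φ v := rfl
    rw [this, qnorm_smul, mul_assoc]
    exact mul_le_mul_of_nonneg_left (hC n v) (norm_nonneg c)

/-- Composition `ψ ↦ φ ψ` with a completely bounded operator, from `CB(F, G)` to `CB(F, E)`. -/
def postcomp (F : Type u) [AddCommGroup F] [Module ℂ F] [QuantumSpace F] (φ : CB G E) :
    CB F G →ₗ[ℂ] CB F E where
  toFun ψ := ⟨(φ : G →ₗ[ℂ] E) ∘ₗ (ψ : F →ₗ[ℂ] G), IsCompletelyBounded.comp φ.2 ψ.2⟩
  map_add' ψ χ := by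
    ext x
    simp
  map_smul' c ψ := by
    ext x
    simp

/-- A matrix of operators from `F` to `E`, seen as an operator from `F` to `M_k(E)`. -/
def toMat {k : ℕ} (T : Matrix (Fin k) (Fin k) (CB F E)) : F →ₗ[ℂ] Matrix (Fin k) (Fin k) E where
  toFun x := Matrix.of fun i j => (T i j : F →ₗ[ℂ] E) x
  map_add' x y := by ext i j; simp
  map_smul' c x := by ext i j; simp

/-- The matrix with entries `T_{ij}(x_{pq})`. -/
def pairing {m k : ℕ} (T : Matrix (Fin k) (Fin k) (CB F E)) (x : Matrix (Fin m) (Fin m) F) :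
    Matrix (Fin m × Fin k) (Fin m × Fin k) E :=
  Matrix.of fun p q => (T p.2 q.2 : F →ₗ[ℂ] E) (x p.1 q.1)

theorem qnorm_amp_toMat {m k : ℕ} (T : Matrix (Fin k) (Fin k) (CB F E))
    (x : Matrix (Fin m) (Fin m) F) : qnorm m (amp m (toMat T) x) = gnorm (pairing T x) :=
  qnorm_reindex _ _

theorem isCompletelyBounded_single {k : ℕ} (i j : Fin k) (φ : CB F E) :
    IsCompletelyBounded (toMat (Matrix.single i j φ)) := by
  obtain ⟨C, hC⟩ := φ.2
  refine ⟨C, fun n v => ?_⟩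
  rw [qnorm_amp_toMat]
  have h0 : pairing (Matrix.single i j φ) v
      = lrMul (pick fun p : Fin n => (p, i))ᵀ (amp n (φ : F →ₗ[ℂ] E) v)
        (pick fun p : Fin n => (p, j)) := by
    ext ⟨p, a⟩ ⟨q, b⟩
    by_cases h1 : i = a <;> by_cases h2 : j = b <;>
      simp [pairing, lrMul, pick, amp, Matrix.single_apply, h1, h2, ite_and]
  rw [h0]
  refine (gnorm_embed_le _ (fun a b h => (Prod.ext_iff.mp h).1)
    (fun a b h => (Prod.ext_iff.mp h).1)).trans ?_
  rw [gnorm_fin]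
  exact hC n v

theorem isCompletelyBounded_toMat {k : ℕ} (T : Matrix (Fin k) (Fin k) (CB F E)) :
    IsCompletelyBounded (toMat T) := by
  have h0 : toMat T = ∑ i, ∑ j, toMat (Matrix.single i j (T i j)) := by
    ext x a b
    simp [toMat, LinearMap.sum_apply, Matrix.sum_apply, Matrix.single_apply, ite_and,
      apply_ite, DFunLike.ite_apply]
  rw [h0]
  exact Submodule.sum_mem (CB F (Matrix (Fin k) (Fin k) E)) fun i _ =>
    Submodule.sum_mem _ fun j _ => isCompletelyBounded_single i j (T i j)

theorem gnorm_pairing_le {m k : ℕ} (T : Matrix (Fin k) (Fin k) (CB F E))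
    (x : Matrix (Fin m) (Fin m) F) : gnorm (pairing T x) ≤ cbNorm (toMat T) * qnorm m x := by
  rw [← qnorm_amp_toMat]
  exact le_cbNorm (isCompletelyBounded_toMat T) m x

theorem cbNorm_toMat_le {k : ℕ} {T : Matrix (Fin k) (Fin k) (CB F E)} {C : ℝ} (hC : 0 ≤ C)
    (h : ∀ (m : ℕ) (x : Matrix (Fin m) (Fin m) F), gnorm (pairing T x) ≤ C * qnorm m x) :
    cbNorm (toMat T) ≤ C :=
  cbNorm_le hC fun m x => by rw [qnorm_amp_toMat]; exact h m x

theorem gnorm_pairing_directSum {m k l : ℕ} (T : Matrix (Fin k) (Fin k) (CB F E))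
    (S : Matrix (Fin l) (Fin l) (CB F E)) (x : Matrix (Fin m) (Fin m) F) :
    gnorm (pairing (directSum T S) x) = max (gnorm (pairing T x)) (gnorm (pairing S x)) := by
  rw [← gnorm_fromBlocks]
  rw [← gnorm_submatrix_equiv (Matrix.fromBlocks _ _ _ _)
    ((Equiv.prodCongr (Equiv.refl (Fin m)) finSumFinEquiv.symm).trans
      (Equiv.prodSumDistrib (Fin m) (Fin k) (Fin l)))]
  congr 1
  ext ⟨p, i⟩ ⟨q, j⟩
  simp only [pairing, directSum, Matrix.of_apply, Matrix.submatrix_apply, Equiv.trans_apply,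
    Equiv.prodCongr_apply, Prod.map_apply, Equiv.refl_apply]
  rcases finSumFinEquiv.symm i with a | a <;> rcases finSumFinEquiv.symm j with b | b <;> simp

/-- `CB(F, E)` is a quantum space: `M_k(CB(F, E))` is identified with `CB(F, M_k(E))` and is given
the completely bounded norm. -/
instance instQuantumSpaceCB : QuantumSpace (CB F E) where
  qnorm k T := cbNorm (toMat T)
  qnorm_add_le k T S := by
    refine cbNorm_toMat_le (add_nonneg (cbNorm_nonneg _) (cbNorm_nonneg _)) fun m x => ?_
    rw [add_mul]
    exact (gnorm_add_le (pairing T x) (pairing S x)).trans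
      (add_le_add (gnorm_pairing_le T x) (gnorm_pairing_le S x))
  qnorm_smul k c T := by
    have key : ∀ (c : ℂ) (T : Matrix (Fin k) (Fin k) (CB F E)),
        cbNorm (toMat (c • T)) ≤ ‖c‖ * cbNorm (toMat T) := by
      intro c T
      refine cbNorm_toMat_le (mul_nonneg (norm_nonneg _) (cbNorm_nonneg _)) fun m x => ?_
      have : pairing (c • T) x = c • pairing T x := rfl
      rw [this, gnorm_smul, mul_assoc]
      exact mul_le_mul_of_nonneg_left (gnorm_pairing_le T x) (norm_nonneg c)
    refine le_antisymm (key c T) ?_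
    by_cases hc : c = 0
    · simpa [hc] using cbNorm_nonneg _
    · have h := key c⁻¹ (c • T)
      rw [inv_smul_smul₀ hc, norm_inv] at h
      have hpos : 0 < ‖c‖ := norm_pos_iff.mpr hc
      calc ‖c‖ * cbNorm (toMat T) ≤ ‖c‖ * (‖c‖⁻¹ * cbNorm (toMat (c • T))) := by gcongr
        _ = cbNorm (toMat (c • T)) := by field_simp
  eq_zero_of_qnorm k T h := by
    ext i j x
    have h1 := gnorm_pairing_le T (Matrix.of fun _ _ : Fin 1 => x)
    rw [h, zero_mul] at h1
    have h2 := eq_zero_of_gnorm (le_antisymm h1 (gnorm_nonneg _))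
    exact congrFun (congrFun h2 (0, i)) (0, j)
  qnorm_directSum k l T S := by
    apply le_antisymm
    · refine cbNorm_toMat_le (le_max_of_le_left (cbNorm_nonneg _)) fun m x => ?_
      rw [gnorm_pairing_directSum]
      have hx := qnorm_nonneg x
      exact max_le
        ((gnorm_pairing_le T x).trans (mul_le_mul_of_nonneg_right (le_max_left _ _) hx))
        ((gnorm_pairing_le S x).trans (mul_le_mul_of_nonneg_right (le_max_right _ _) hx))
    · refine max_le ?_ ?_
      · refine cbNorm_toMat_le (cbNorm_nonneg _) fun m x => ?_
        refine le_trans ?_ (gnorm_pairing_le (directSum T S) x)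
        rw [gnorm_pairing_directSum]
        exact le_max_left _ _
      · refine cbNorm_toMat_le (cbNorm_nonneg _) fun m x => ?_
        refine le_trans ?_ (gnorm_pairing_le (directSum T S) x)
        rw [gnorm_pairing_directSum]
        exact le_max_right _ _
  qnorm_lrMul_le k l α T β := by
    have hα := opNorm_nonneg α
    have hβ := opNorm_nonneg β
    have hT := cbNorm_nonneg (toMat T)
    refine cbNorm_toMat_le (by positivity) fun m x => ?_
    have h0 : pairing (lrMul α T β) x = lrMul
        (Matrix.of fun (p : Fin m × Fin l) (q : Fin m × Fin k) =>
          if p.1 = q.1 then α p.2 q.2 else 0) (pairing T x)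
        (Matrix.of fun (p : Fin m × Fin k) (q : Fin m × Fin l) =>
          if p.1 = q.1 then β p.2 q.2 else 0) := by
      ext ⟨p, i⟩ ⟨q, j⟩
      simp [lrMul, pairing, Fintype.sum_prod_type]
    rw [h0]
    refine (gnorm_lrMul_le _ _ _).trans ?_
    have h1 := opNorm_one_tensor_le (μ := Fin m) α
    have h2 := opNorm_one_tensor_le (μ := Fin m) β
    have h3 := gnorm_pairing_le T x
    have h4 := gnorm_nonneg (pairing T x)
    have hx := qnorm_nonneg x
    calc _ ≤ opNorm α * (cbNorm (toMat T) * qnorm m x) * opNorm β :=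
          mul_le_mul (mul_le_mul h1 h3 h4 hα) h2 (opNorm_nonneg _) (by positivity)
      _ = _ := by ring

/-- `f` is a completely isometric isomorphism: every amplification is an isometric isomorphism. -/
def IsCompletelyIsometricIso (f : F →ₗ[ℂ] E) : Prop :=
  ∀ n : ℕ, Function.Bijective (amp n f) ∧
    ∀ v : Matrix (Fin n) (Fin n) F, qnorm n (amp n f v) = qnorm n v

end CB

/-! ### Trace-class operators on `ℂ^n` -/

/-- The space `N_n` of trace-class operators on `ℂ^n`, represented by their matrices. -/
def TraceClass (n : ℕ) : Type := Matrix (Fin n) (Fin n) ℂ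

namespace TraceClass

variable (n : ℕ)

instance : AddCommGroup (TraceClass n) := inferInstanceAs (AddCommGroup (Matrix (Fin n) (Fin n) ℂ))

instance : Module ℂ (TraceClass n) := inferInstanceAs (Module ℂ (Matrix (Fin n) (Fin n) ℂ))

variable {n}

/-- The matrix of a trace-class operator. -/
def toMatrix : TraceClass n ≃ₗ[ℂ] Matrix (Fin n) (Fin n) ℂ := LinearEquiv.refl ℂ _

/-- The functional `a ↦ tr(ba)` on `M_n = B(ℂ^n)`. -/
def functional (b : TraceClass n) : Matrix (Fin n) (Fin n) ℂ →ₗ[ℂ] ℂ where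
  toFun a := Matrix.trace (b.toMatrix * a)
  map_add' a a' := by rw [mul_add, Matrix.trace_add]
  map_smul' c a := by rw [Matrix.mul_smul, Matrix.trace_smul, RingHom.id_apply]

end TraceClass

theorem isCompletelyBounded_entry {n : ℕ} (i j : Fin n) :
    IsCompletelyBounded (Matrix.entryLinearMap ℂ ℂ i j : Matrix (Fin n) (Fin n) ℂ →ₗ[ℂ] ℂ) := by
  refine ⟨1, fun m v => ?_⟩
  have h : amp m (Matrix.entryLinearMap ℂ ℂ i j) v
      = (Matrix.comp _ _ _ _ ℂ v).submatrix (fun p => (p, i)) (fun p => (p, j)) := rfl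
  rw [one_mul, h, ← gnorm_fin]
  refine (gnorm_submatrix_le _ (fun a b h => (Prod.ext_iff.mp h).1)
    (fun a b h => (Prod.ext_iff.mp h).1)).trans (le_of_eq ?_)
  exact (qnorm_reindex _ _).symm

theorem TraceClass.isCompletelyBounded_functional {n : ℕ} (b : TraceClass n) :
    IsCompletelyBounded b.functional := by
  have h0 : b.functional = ∑ i, ∑ j, b.toMatrix i j •
      (Matrix.entryLinearMap ℂ ℂ j i : Matrix (Fin n) (Fin n) ℂ →ₗ[ℂ] ℂ) := by
    refine LinearMap.ext fun a => ?_
    simp [TraceClass.functional, Matrix.trace, Matrix.mul_apply, LinearMap.sum_apply]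
  rw [h0]
  exact Submodule.sum_mem (CB (Matrix (Fin n) (Fin n) ℂ) ℂ) fun i _ =>
    Submodule.sum_mem _ fun j _ => Submodule.smul_mem _ _ (isCompletelyBounded_entry j i)

/-- The identification of `N_n` with the quantum dual space `CB(M_n, ℂ)` of `M_n = B(ℂ^n)`, taking
`b` to the functional `a ↦ tr(ba)`, as an (injective) linear map. -/
def TraceClass.toDual (n : ℕ) : TraceClass n →ₗ[ℂ] CB (Matrix (Fin n) (Fin n) ℂ) ℂ where
  toFun b := ⟨b.functional, b.isCompletelyBounded_functional⟩
  map_add' b c := by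
    refine Subtype.ext (LinearMap.ext fun a => ?_)
    simp [TraceClass.functional, add_mul]
  map_smul' c b := by
    refine Subtype.ext (LinearMap.ext fun a => ?_)
    simp [TraceClass.functional]

theorem TraceClass.toDual_injective (n : ℕ) : Function.Injective (TraceClass.toDual n) := by
  intro b c h
  apply TraceClass.toMatrix.injective
  refine Matrix.ext_iff_trace_mul_right.mpr fun a => ?_
  exact LinearMap.congr_fun (congrArg Subtype.val h) a

/-- The quantum norm on `N_n`, induced from the quantum dual space of `M_n = B(ℂ^n)`; the norm on
`N_n = M_1(N_n)` itself is the trace-class norm. -/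
instance instQuantumSpaceTraceClass (n : ℕ) : QuantumSpace (TraceClass n) :=
  QuantumSpace.induced (TraceClass.toDual n) (TraceClass.toDual_injective n)

/-- The elementary tensor `a ⊗ x` in `M_n ⊗ E = M_n(E)`. -/
def elemTensor {n : ℕ} {E : Type u} [AddCommGroup E] [Module ℂ E] (a : Matrix (Fin n) (Fin n) ℂ)
    (x : E) : Matrix (Fin n) (Fin n) E :=
  Matrix.of fun i j => a i j • x

end

end Quantum

namespace Quantum

open Matrix QuantumSpace

noncomputable section

universe u

/-! The map sends `v` to `b ↦ ∑ b_{lk} v_{kl}`. It is bijective because an operator on `N_n` is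
determined, freely, by its values on the matrix units; uniqueness and naturality are then linear
algebra. All the content is in the norms.

For the lower bound, a matrix `V` is recovered, up to a permutation of indices, by pairing its image
with `TraceClass.idMatrix`. This element of `M_n(N_n)` corresponds to the identity operator of
`M_n`, so its norm is at most 1.

The upper bound is `qnorm_amp_traceContraction_le`. An element `x` of `M_r(N_n)` is a completely
bounded map from `M_n` to `M_r` whose cb norm is the norm of `x`, and the claim is that `x ⊗ id_E`
maps `M_n(E)` to `M_r(E)` with norm at most that cb norm. For `E = M_r` this is the definition of
the cb norm. The general case reduces to it because norms in `M_r(E)` are detected, up to `ε`, by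
complete contractions `E → M_r`: a norming functional `f` on `M_r(E)` has the form `f(v) = L(B v
C)`, where `B` and `C` have Hilbert-Schmidt norm close to 1 and `x ↦ (L(e_{pq} ⊗ x))_{pq}` is
completely contractive (`exists_hsSq_bounded_factor`, `opNorm_blockMatrix_le`).

This factorization comes from Hahn-Banach separation. Ruan's axioms make the set of triples `(α α*,
β* β, f(α v β))`, with `v` in the unit ball, a convex cone that misses an open convex set. A
separating functional yields two positive functionals on `M_r` that dominate `f`, and square roots
of their densities are `B` and the adjoint of `C`. -/

theorem exists_norming_functional {E : Type*} [AddCommGroup E] [Module ℂ E] [QuantumSpace E] {r : ℕ}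
    (y : Matrix (Fin r) (Fin r) E) :
    ∃ f : Matrix (Fin r) (Fin r) E →ₗ[ℂ] ℂ, (∀ v, ‖f v‖ ≤ qnorm r v) ∧ f y = qnorm r y := by
  let N : AddGroupNorm (Matrix (Fin r) (Fin r) E) :=
    { toFun := qnorm r
      map_zero' := qnorm_zero r
      add_le' := qnorm_add_le r
      neg' := fun v => by simpa using qnorm_smul r (-1) v
      eq_zero_of_map_eq_zero' := eq_zero_of_qnorm r }
  let _ : NormedAddCommGroup (Matrix (Fin r) (Fin r) E) := N.toNormedAddCommGroup
  let _ : NormedSpace ℂ (Matrix (Fin r) (Fin r) E) := ⟨fun c v => (qnorm_smul r c v).le⟩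
  obtain ⟨g, hg, hy⟩ := exists_dual_vector'' ℂ y
  refine ⟨g.toLinearMap, fun v => ?_, hy⟩
  exact (g.le_opNorm v).trans (mul_le_of_le_one_left (norm_nonneg v) hg)

/-! ### Hilbert-Schmidt norms and the algebra of two-sided products -/

/-- The square of the Hilbert-Schmidt norm of a matrix. -/
def hsSq {ι κ : Type*} [Fintype ι] [Fintype κ] (M : Matrix κ ι ℂ) : ℝ := ∑ i, ∑ j, ‖M i j‖ ^ 2

section HilbertSchmidt

variable {ι κ : Type*} [Fintype ι] [Fintype κ]

theorem hsSq_nonneg (M : Matrix κ ι ℂ) : 0 ≤ hsSq M :=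
  Finset.sum_nonneg fun _ _ => Finset.sum_nonneg fun _ _ => by positivity

theorem trace_mul_conjTranspose_self (M : Matrix κ ι ℂ) : trace (M * Mᴴ) = hsSq M := by
  simp [hsSq, trace, mul_apply, Complex.mul_conj, Complex.normSq_eq_norm_sq]

theorem hsSq_smul (c : ℂ) (M : Matrix κ ι ℂ) : hsSq (c • M) = ‖c‖ ^ 2 * hsSq M := by
  simp [hsSq, Finset.mul_sum, mul_pow]

end HilbertSchmidt

section LrMul

variable {E : Type*} [AddCommGroup E] [Module ℂ E] {ι κ μ : Type*} [Fintype ι] [Fintype μ]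

theorem lrMul_smul (c : ℂ) (α : Matrix κ ι ℂ) (v : Matrix ι ι E) (β : Matrix ι κ ℂ) :
    lrMul α (c • v) β = c • lrMul α v β := by
  ext p q
  simp [lrMul, Finset.smul_sum, smul_smul, mul_comm]

theorem smul_lrMul (c : ℂ) (α : Matrix κ ι ℂ) (v : Matrix ι ι E) (β : Matrix ι κ ℂ) :
    lrMul (c • α) v β = c • lrMul α v β := by
  ext p q
  simp [lrMul, Finset.smul_sum, smul_smul, mul_assoc]

theorem lrMul_smul_right (c : ℂ) (α : Matrix κ ι ℂ) (v : Matrix ι ι E) (β : Matrix ι κ ℂ) :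
    lrMul α v (c • β) = c • lrMul α v β := by
  ext p q
  simp [lrMul, Finset.smul_sum, smul_smul, mul_left_comm]

theorem lrMul_fromBlocks (α : Matrix κ ι ℂ) (v : Matrix ι ι E) (β : Matrix ι κ ℂ)
    (α' : Matrix κ μ ℂ) (v' : Matrix μ μ E) (β' : Matrix μ κ ℂ) :
    lrMul (fromCols α α') (fromBlocks v 0 0 v') (fromRows β β')
      = lrMul α v β + lrMul α' v' β' := by
  ext p q
  simp [lrMul]

theorem lrMul_lrMul {ν : Type*} [Fintype κ] (γ : Matrix ν κ ℂ) (α : Matrix κ ι ℂ)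
    (v : Matrix ι ι E) (β : Matrix ι κ ℂ) (δ : Matrix κ ν ℂ) :
    lrMul γ (lrMul α v β) δ = lrMul (γ * α) v (β * δ) := by
  ext p q
  simp only [lrMul, of_apply, mul_apply, Finset.smul_sum, smul_smul, Finset.sum_mul_sum,
    Finset.sum_smul]
  simp only [← Fintype.sum_prod_type']
  refine Fintype.sum_equiv
    ⟨fun x => (x.2.2.1, x.2.2.2, x.1, x.2.1), fun x => (x.2.2.1, x.2.2.2, x.1, x.2.1),
      fun _ => rfl, fun _ => rfl⟩ _ _ fun x => ?_
  simp only [Equiv.coe_fn_mk]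
  congr 1
  ring

end LrMul

/-! ### Dominating a contractive functional by two positive functionals -/

section Separation

variable {E : Type*} [AddCommGroup E] [Module ℂ E] [QuantumSpace E] {r : ℕ}

/-- The triples `(α α*, β* β, f(α v β))`, where `v` is in the unit ball of some `M_k(E)`. -/
def factorTriples (f : Matrix (Fin r) (Fin r) E →ₗ[ℂ] ℂ) :
    Set (Matrix (Fin r) (Fin r) ℂ × Matrix (Fin r) (Fin r) ℂ × ℂ) :=
  {x | ∃ (ι : Type) (_ : Fintype ι) (_ : DecidableEq ι) (α : Matrix (Fin r) ι ℂ)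
    (v : Matrix ι ι E) (β : Matrix ι (Fin r) ℂ), gnorm v ≤ 1 ∧
      x = (α * αᴴ, βᴴ * β, f (lrMul α v β))}

/-- Block rows and columns turn the sum of two products into one product with middle factor `v ⊕
v'`. The direct sum axiom keeps it in the unit ball; this is why the index set of `v` must be
allowed to vary. -/
theorem add_mem_factorTriples (f : Matrix (Fin r) (Fin r) E →ₗ[ℂ] ℂ)
    {x y : Matrix (Fin r) (Fin r) ℂ × Matrix (Fin r) (Fin r) ℂ × ℂ}
    (hx : x ∈ factorTriples f) (hy : y ∈ factorTriples f) : x + y ∈ factorTriples f := by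
  obtain ⟨ι, _, _, α, v, β, hv, rfl⟩ := hx
  obtain ⟨κ, _, _, α', v', β', hv', rfl⟩ := hy
  refine ⟨ι ⊕ κ, inferInstance, inferInstance, fromCols α α', fromBlocks v 0 0 v',
    fromRows β β', ?_, ?_⟩
  · rw [gnorm_fromBlocks]
    exact max_le hv hv'
  · rw [lrMul_fromBlocks, map_add, conjTranspose_fromCols_eq_fromRows_conjTranspose,
      conjTranspose_fromRows_eq_fromCols_conjTranspose, fromCols_mul_fromRows,
      fromCols_mul_fromRows]
    rfl

theorem smul_mem_factorTriples (f : Matrix (Fin r) (Fin r) E →ₗ[ℂ] ℂ)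
    {x : Matrix (Fin r) (Fin r) ℂ × Matrix (Fin r) (Fin r) ℂ × ℂ}
    (hx : x ∈ factorTriples f) {t : ℝ} (ht : 0 ≤ t) : t • x ∈ factorTriples f := by
  obtain ⟨ι, _, _, α, v, β, hv, rfl⟩ := hx
  have h : ((√t : ℝ) : ℂ) * (√t : ℝ) = (t : ℂ) := by
    rw [← Complex.ofReal_mul, Real.mul_self_sqrt ht]
  refine ⟨ι, inferInstance, inferInstance, ((√t : ℝ) : ℂ) • α, v, ((√t : ℝ) : ℂ) • β, hv, ?_⟩
  rw [smul_lrMul, lrMul_smul_right, smul_smul, h, map_smul]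
  simp only [conjTranspose_smul, smul_mul, Matrix.mul_smul, smul_smul, Complex.star_def,
    Complex.conj_ofReal, h]
  ext <;> simp

theorem trace_mul_vecMulVec (D : Matrix (Fin r) (Fin r) ℂ) (x y : Fin r → ℂ) :
    trace (D * vecMulVec x y) = y ⬝ᵥ D *ᵥ x := by
  rw [mul_vecMulVec, trace_vecMulVec, dotProduct_comm]

theorem trace_conjTranspose_mul_of_isHermitian (D : Matrix (Fin r) (Fin r) ℂ)
    {P : Matrix (Fin r) (Fin r) ℂ} (hP : P.IsHermitian) :
    trace (Dᴴ * P) = star (trace (D * P)) := by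
  rw [← trace_conjTranspose, conjTranspose_mul, hP.eq, trace_mul_comm]

-- A functional with nonnegative real part on rank-one positive matrices has a density with positive
-- semidefinite Hermitian part, and `B` is a root of that part in the sense `Bᴴ B`. Invertibility of
-- `B` is bought by a small multiple of the identity, paid for by `ε`.
open scoped ComplexOrder MatrixOrder Matrix.Norms.L2Operator in
theorem exists_hsSq_bound {s : Matrix (Fin r) (Fin r) ℂ →ₗ[ℂ] ℂ}
    (hs : ∀ x : Fin r → ℂ, 0 ≤ (s (vecMulVec x (star x))).re) {ε : ℝ} (hε : 0 < ε) :
    ∃ B : Matrix (Fin r) (Fin r) ℂ, IsUnit B ∧ hsSq B ≤ (s 1).re + ε ∧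
      ∀ (ι : Type) [Fintype ι] (α : Matrix (Fin r) ι ℂ), (s (α * αᴴ)).re ≤ hsSq (B * α) := by
  obtain ⟨D, hD⟩ : ∃ D : Matrix (Fin r) (Fin r) ℂ, ∀ P, trace (D * P) = s P := by
    refine ⟨of fun j i => s (single i j 1), fun P => ?_⟩
    conv_rhs => rw [matrix_eq_sum_single P]
    simp only [trace, diag_apply, mul_apply, of_apply, map_sum]
    rw [Finset.sum_comm]
    refine Finset.sum_congr rfl fun i _ => Finset.sum_congr rfl fun j _ => ?_
    rw [mul_comm, ← smul_eq_mul, ← map_smul, smul_single, smul_eq_mul, mul_one]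
  -- Adding `δ • 1` raises the trace by `δ r ≤ ε`; the `r + 1` covers `r = 0`.
  set δ : ℝ := ε / (r + 1) with hδ
  have hδ0 : 0 < δ := by positivity
  -- Only real parts on Hermitian matrices matter, and the Hermitian part of the density represents
  -- them.
  set M : Matrix (Fin r) (Fin r) ℂ := (2⁻¹ : ℂ) • (D + Dᴴ) with hM
  have htr : ∀ P : Matrix (Fin r) (Fin r) ℂ, P.IsHermitian → trace (M * P) = ((s P).re : ℂ) := by
    intro P hP
    rw [hM, smul_mul, trace_smul, add_mul, trace_add, trace_conjTranspose_mul_of_isHermitian D hP,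
      hD, Complex.star_def, Complex.add_conj]
    simp
  have hMp : M.PosSemidef := by
    refine PosSemidef.of_dotProduct_mulVec_nonneg ?_ fun x => ?_
    · simp [hM, IsHermitian, conjTranspose_smul, add_comm]
    · rw [← trace_mul_vecMulVec, htr _ (by simp [IsHermitian, conjTranspose_vecMulVec])]
      exact_mod_cast hs x
  have hpos : ((δ : ℂ) • (1 : Matrix (Fin r) (Fin r) ℂ) + M).PosDef :=
    (PosDef.one.smul (by exact_mod_cast hδ0)).add_posSemidef hMp
  obtain ⟨B, hB⟩ := CStarAlgebra.nonneg_iff_eq_star_mul_self.mp hpos.posSemidef.nonneg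
  rw [star_eq_conjTranspose] at hB
  have key : ∀ (ι : Type) [Fintype ι] (α : Matrix (Fin r) ι ℂ),
      hsSq (B * α) = δ * hsSq α + (s (α * αᴴ)).re := by
    intro ι _ α
    have h := htr (α * αᴴ) (by simp [IsHermitian])
    have h2 : (hsSq (B * α) : ℂ) = δ * hsSq α + (s (α * αᴴ)).re := by
      have h3 : trace ((B * α) * (B * α)ᴴ) = trace ((Bᴴ * B) * (α * αᴴ)) := by
        rw [conjTranspose_mul, trace_mul_comm, Matrix.mul_assoc, trace_mul_comm]
        simp only [Matrix.mul_assoc]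
      rw [← trace_mul_conjTranspose_self, ← trace_mul_conjTranspose_self, ← h, h3, ← hB, add_mul,
        trace_add, smul_mul, trace_smul, one_mul, smul_eq_mul]
    exact_mod_cast h2
  refine ⟨B, ?_, ?_, fun ι _ α => ?_⟩
  · have := hpos.isUnit
    rw [hB] at this
    rw [isUnit_iff_isUnit_det, det_mul] at this
    exact (isUnit_iff_isUnit_det _).mpr (isUnit_of_mul_isUnit_right this)
  · have h := key (Fin r) 1
    have h1 : hsSq (1 : Matrix (Fin r) (Fin r) ℂ) = r := by
      have := trace_mul_conjTranspose_self (1 : Matrix (Fin r) (Fin r) ℂ)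
      simp at this
      exact_mod_cast this.symm
    simp only [mul_one, conjTranspose_one, h1] at h
    rw [h]
    have : δ * r ≤ ε := by
      rw [hδ, div_mul_eq_mul_div, div_le_iff₀ (by positivity)]
      nlinarith
    linarith
  · rw [key]
    have := hsSq_nonneg α
    nlinarith

-- The open set where `‖P‖ + ‖Q‖ < 2 Re c` is disjoint from the cone since `|f(α v β)| ≤ ‖α‖ ‖β‖ ≤
-- (‖α‖² + ‖β‖²) / 2`. Separation from a cone can be taken at level zero.
open scoped Matrix.Norms.L2Operator in
theorem exists_separating_functional {f : Matrix (Fin r) (Fin r) E →ₗ[ℂ] ℂ}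
    (hf : ∀ v, ‖f v‖ ≤ qnorm r v) :
    ∃ g : (Matrix (Fin r) (Fin r) ℂ × Matrix (Fin r) (Fin r) ℂ × ℂ) →ₗ[ℂ] ℂ,
      (∀ x, opNorm x.1 + opNorm x.2.1 < 2 * x.2.2.re → (g x).re < 0) ∧
      ∀ x ∈ factorTriples f, 0 ≤ (g x).re := by
  let B : Set (Matrix (Fin r) (Fin r) ℂ × Matrix (Fin r) (Fin r) ℂ × ℂ) :=
    {x | ‖x.1‖ + ‖x.2.1‖ < 2 * x.2.2.re}
  have hBo : IsOpen B := isOpen_lt (by fun_prop) (by fun_prop)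
  have hB0 : ∀ x, x ∈ B ↔ ‖x.1‖ + ‖x.2.1‖ < 2 * x.2.2.re := fun _ => Iff.rfl
  have hBc : Convex ℝ B := by
    rw [convex_iff_forall_pos]
    intro x hx y hy a b ha hb _
    rw [hB0] at hx hy ⊢
    have h1 := norm_add_le (a • x.1) (b • y.1)
    have h2 := norm_add_le (a • x.2.1) (b • y.2.1)
    simp only [norm_smul, Real.norm_of_nonneg ha.le, Real.norm_of_nonneg hb.le] at h1 h2
    simp only [Prod.fst_add, Prod.snd_add, Prod.smul_fst, Prod.smul_snd, Complex.add_re,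
      Complex.real_smul, Complex.re_ofReal_mul]
    nlinarith [mul_lt_mul_of_pos_left hx ha, mul_lt_mul_of_pos_left hy hb]
  have hCc : Convex ℝ (factorTriples f) := fun x hx y hy a b ha hb _ =>
    add_mem_factorTriples f (smul_mem_factorTriples f hx ha) (smul_mem_factorTriples f hy hb)
  have hd : Disjoint B (factorTriples f) := by
    rw [Set.disjoint_left]
    rintro _ hx ⟨ι, _, _, α, v, β, hv, rfl⟩
    rw [hB0] at hx
    have h1 : ‖f (lrMul α v β)‖ ≤ ‖α‖ * ‖β‖ := by
      refine (hf _).trans ?_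
      rw [← gnorm_fin]
      refine (gnorm_lrMul_le α v β).trans ?_
      rw [opNorm_eq, opNorm_eq]
      exact mul_le_mul_of_nonneg_right (mul_le_of_le_one_right (norm_nonneg _) hv) (norm_nonneg _)
    have h2 : ‖α * αᴴ‖ = ‖α‖ * ‖α‖ := by
      simpa [l2_opNorm_conjTranspose] using l2_opNorm_conjTranspose_mul_self αᴴ
    have h3 := l2_opNorm_conjTranspose_mul_self β
    have h4 := Complex.re_le_norm (f (lrMul α v β))
    simp only [h2, h3] at hx
    nlinarith [sq_nonneg (‖α‖ - ‖β‖)]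
  obtain ⟨g, u, hgB, hgC⟩ := RCLike.geometric_hahn_banach_open (𝕜 := ℂ) hBc hBo hCc hd
  have hu : u ≤ 0 := by
    have h1 : lrMul (0 : Matrix (Fin r) Unit ℂ) (0 : Matrix Unit Unit E) 0 = 0 := by
      ext p q
      simp [lrMul]
    have h0 : (0 : Matrix (Fin r) (Fin r) ℂ × Matrix (Fin r) (Fin r) ℂ × ℂ) ∈ factorTriples f :=
      ⟨Unit, inferInstance, inferInstance, 0, 0, 0, by simp [gnorm, qnorm_zero],
        by
          rw [h1, map_zero, Matrix.zero_mul, Matrix.mul_zero]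
          rfl⟩
    simpa using hgC 0 h0
  refine ⟨g.toLinearMap, fun x hx => (hgB x hx).trans_le hu, fun x hx => ?_⟩
  by_contra! hlt
  have hlt' : (g x).re < 0 := hlt
  -- Scaling `x` by this factor would give a point of the cone where the real part of `g` is `u -
  -- 1`, below the separating level `u`.
  have ht : 0 ≤ (u - 1) / (g x).re := div_nonneg_of_nonpos (by linarith) hlt'.le
  have h := hgC _ (smul_mem_factorTriples f hx ht)
  rw [← Complex.coe_smul, map_smul, smul_eq_mul] at h
  simp only [RCLike.re_to_complex, Complex.re_ofReal_mul] at h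
  rw [div_mul_cancel₀ _ hlt'.ne] at h
  linarith

/-- The first two components of the separating functional, normalized by its coefficient `γ` on the
third, are the two dominating functionals; `exists_hsSq_bound` converts each into a Hilbert-Schmidt
norm. -/
theorem exists_hsSq_factorization {f : Matrix (Fin r) (Fin r) E →ₗ[ℂ] ℂ}
    (hf : ∀ v, ‖f v‖ ≤ qnorm r v) {ε : ℝ} (hε : 0 < ε) :
    ∃ B C : Matrix (Fin r) (Fin r) ℂ, IsUnit B ∧ IsUnit C ∧ hsSq B ≤ 1 + ε ∧ hsSq C ≤ 1 + ε ∧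
      ∀ (ι : Type) [Fintype ι] [DecidableEq ι] (α : Matrix (Fin r) ι ℂ) (v : Matrix ι ι E)
        (β : Matrix ι (Fin r) ℂ), gnorm v ≤ 1 →
          2 * ‖f (lrMul α v β)‖ ≤ hsSq (B * α) + hsSq (β * C) := by
  obtain ⟨g, hgB, hgC⟩ := exists_separating_functional hf
  set γ : ℂ := g (0, 0, 1) with hγ
  have hdec : ∀ P Q c, g (P, Q, c) = g (P, 0, 0) + g (0, Q, 0) + c * γ := by
    intro P Q c
    rw [hγ, ← smul_eq_mul, ← map_smul, ← map_add, ← map_add]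
    simp
  have hγ0 : γ.re < 0 := hgB (0, 0, 1) (by
    simp only [opNorm, map_zero, norm_zero, Complex.one_re]; norm_num)
  have hN : 0 < ‖γ‖ := norm_pos_iff.mpr fun h => by simp [h] at hγ0
  have hbound : ∀ (ι : Type) [Fintype ι] [DecidableEq ι] (α : Matrix (Fin r) ι ℂ)
      (v : Matrix ι ι E) (β : Matrix ι (Fin r) ℂ), gnorm v ≤ 1 →
        ‖γ‖ * ‖f (lrMul α v β)‖ ≤ (g (α * αᴴ, 0, 0)).re + (g (0, βᴴ * β, 0)).re := by
    intro ι _ _ α v β hv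
    obtain ⟨ω, hω, hz⟩ : ∃ ω : ℂ, ‖ω‖ = 1 ∧
        ω * (γ * f (lrMul α v β)) = -(‖γ * f (lrMul α v β)‖ : ℂ) := by
      obtain ⟨c, hc, h⟩ := Complex.exists_norm_eq_mul_self (γ * f (lrMul α v β))
      -- Multiplying `v` by a phase keeps it in the unit ball, so the `f` term can be made as
      -- negative as possible.
      exact ⟨-c, by rwa [norm_neg], by rw [h, neg_mul]⟩
    have h := hgC (α * αᴴ, βᴴ * β, f (lrMul α (ω • v) β))
      ⟨ι, inferInstance, inferInstance, α, ω • v, β, by rwa [gnorm_smul, hω, one_mul], rfl⟩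
    rw [hdec, lrMul_smul, map_smul, smul_eq_mul,
      show ω * f (lrMul α v β) * γ = ω * (γ * f (lrMul α v β)) by ring, hz, norm_mul] at h
    simp only [Complex.add_re, Complex.neg_re, Complex.ofReal_re] at h
    linarith
  have hunit : ∀ P Q, opNorm P + opNorm Q ≤ 1 →
      (g (P, 0, 0)).re + (g (0, Q, 0)).re ≤ ‖γ‖ / 2 * (1 + ε / 2) := by
    intro P Q hPQ
    -- The value `1/2` would only reach the boundary of the open set; the extra `ε / 4` makes the
    -- inequality strict.
    have h := hgB (P, Q, (((1 + ε / 2) / 2 : ℝ) : ℂ)) (by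
      simp only [Complex.ofReal_re]; linarith)
    rw [hdec] at h
    simp only [Complex.add_re, Complex.re_ofReal_mul] at h
    have h2 := (abs_le.mp (Complex.abs_re_le_norm γ)).1
    nlinarith
  have h10 : opNorm (1 : Matrix (Fin r) (Fin r) ℂ) + opNorm (0 : Matrix (Fin r) (Fin r) ℂ) ≤ 1 := by
    have := opNorm_one_le (ι := Fin r)
    simpa [opNorm] using this
  let s : Matrix (Fin r) (Fin r) ℂ →ₗ[ℂ] ℂ :=
    -- With this scaling the real part at the identity is at most `1 + ε / 2`, and the other `ε / 2`
    -- is left for `exists_hsSq_bound`.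
    ((2 / ‖γ‖ : ℝ) : ℂ) • (g ∘ₗ LinearMap.inl ℂ _ _)
  let t : Matrix (Fin r) (Fin r) ℂ →ₗ[ℂ] ℂ :=
    ((2 / ‖γ‖ : ℝ) : ℂ) • (g ∘ₗ LinearMap.inr ℂ _ _ ∘ₗ LinearMap.inl ℂ _ _)
  have hs : ∀ P, (s P).re = 2 / ‖γ‖ * (g (P, 0, 0)).re := fun P => Complex.re_ofReal_mul _ _
  have ht : ∀ P, (t P).re = 2 / ‖γ‖ * (g (0, P, 0)).re := fun P => Complex.re_ofReal_mul _ _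
  have hg0 : g (0, 0, 0) = 0 := map_zero g
  obtain ⟨B, hB, hB1, hBs⟩ := exists_hsSq_bound (s := s) (fun x => by
    rw [hs]
    refine mul_nonneg (by positivity) ?_
    -- A single column with `v = 0` and `β = 0` isolates the first functional at a rank-one positive
    -- matrix.
    have h := hbound Unit (replicateCol Unit x) 0 0 (by simp [gnorm, qnorm_zero])
    rw [conjTranspose_replicateCol, ← vecMulVec_eq] at h
    simp only [Matrix.mul_zero, hg0, Complex.zero_re, add_zero] at h
    exact le_trans (by positivity) h) (half_pos hε)
  obtain ⟨C, hC, hC1, hCt⟩ := exists_hsSq_bound (s := t) (fun x => by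
    rw [ht]
    refine mul_nonneg (by positivity) ?_
    have h := hbound Unit 0 0 (replicateCol Unit x)ᴴ (by simp [gnorm, qnorm_zero])
    rw [conjTranspose_conjTranspose, conjTranspose_replicateCol, ← vecMulVec_eq] at h
    simp only [Matrix.zero_mul, hg0, Complex.zero_re, zero_add] at h
    exact le_trans (by positivity) h) (half_pos hε)
  have hCH : ∀ {ι κ : Type} [Fintype ι] [Fintype κ] (M : Matrix κ ι ℂ), hsSq Mᴴ = hsSq M := by
    intro ι κ _ _ M
    simp only [hsSq, conjTranspose_apply, norm_star]
    exact Finset.sum_comm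
  have hone : ∀ z : ℝ, z ≤ ‖γ‖ / 2 * (1 + ε / 2) → 2 / ‖γ‖ * z + ε / 2 ≤ 1 + ε := by
    intro z hz
    have : 2 / ‖γ‖ * z ≤ 2 / ‖γ‖ * (‖γ‖ / 2 * (1 + ε / 2)) := by gcongr
    have h2 : 2 / ‖γ‖ * (‖γ‖ / 2 * (1 + ε / 2)) = 1 + ε / 2 := by field_simp
    linarith
  -- The bound for `t` is applied to `βᴴ` and controls `C * βᴴ`, whose adjoint is `β * Cᴴ`.
  refine ⟨B, Cᴴ, hB, hC.star, hB1.trans ?_, ?_, fun ι _ _ α v β hv => ?_⟩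
  · rw [hs]
    refine hone _ ?_
    simpa [hg0] using hunit 1 0 h10
  · rw [hCH]
    refine hC1.trans ?_
    rw [ht]
    refine hone _ ?_
    simpa [hg0] using hunit 0 1 (by rwa [add_comm])
  · have h1 := hBs ι α
    have h2 := hCt ι βᴴ
    rw [← hCH, conjTranspose_mul, conjTranspose_conjTranspose] at h2
    rw [hs] at h1
    rw [ht] at h2
    have h3 := mul_le_mul_of_nonneg_left (hbound ι α v β hv) (show 0 ≤ 2 / ‖γ‖ by positivity)
    have h4 : 2 / ‖γ‖ * (‖γ‖ * ‖f (lrMul α v β)‖) = 2 * ‖f (lrMul α v β)‖ := by field_simp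
    linarith

end Separation

/-! ### Factorization through a complete contraction into matrices -/

section Factorization

variable {E : Type*} [AddCommGroup E] [Module ℂ E] {r n : ℕ}

/-- The map `v ↦ α v β` as a linear map. -/
def lrMulₗ {ι κ : Type*} [Fintype ι] (α : Matrix κ ι ℂ) (β : Matrix ι κ ℂ) :
    Matrix ι ι E →ₗ[ℂ] Matrix κ κ E where
  toFun v := lrMul α v β
  map_add' v w := by
    ext p q
    simp [lrMul, Finset.sum_add_distrib]
  map_smul' c v := lrMul_smul c α v β

/-- The scalar matrix with entries `L(e_{pq} ⊗ V_{kl})`. -/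
def blockMatrix (L : Matrix (Fin r) (Fin r) E →ₗ[ℂ] ℂ) (V : Matrix (Fin n) (Fin n) E) :
    Matrix (Fin r) (Fin r) (Matrix (Fin n) (Fin n) ℂ) :=
  of fun p q => of fun k l => L (single p q (V k l))

theorem map_lrMul_eq_sum (L : Matrix (Fin r) (Fin r) E →ₗ[ℂ] ℂ) {ι : Type} [Fintype ι]
    (α : Matrix (Fin r) ι ℂ) (v : Matrix ι ι E) (β : Matrix ι (Fin r) ℂ) :
    L (lrMul α v β) = ∑ p, ∑ q, ∑ k, ∑ l, α p k * β l q * L (single p q (v k l)) := by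
  conv_lhs => rw [matrix_eq_sum_single (lrMul α v β)]
  simp only [map_sum]
  refine Finset.sum_congr rfl fun p _ => Finset.sum_congr rfl fun q _ => ?_
  have h : ∀ x : E, L (single p q x) = (L ∘ₗ singleLinearMap ℂ p q) x := fun _ => rfl
  simp only [h, lrMul, of_apply, map_sum, map_smul, smul_eq_mul]

variable [QuantumSpace E]

/-- Replacing `α, β` by `√t α, β / √t` leaves the product unchanged, so optimizing over `t` turns
the arithmetic mean into the geometric one. -/
theorem norm_sq_le_of_two_mul_le {L : Matrix (Fin r) (Fin r) E →ₗ[ℂ] ℂ}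
    (h : ∀ (ι : Type) [Fintype ι] [DecidableEq ι] (α : Matrix (Fin r) ι ℂ) (v : Matrix ι ι E)
        (β : Matrix ι (Fin r) ℂ), gnorm v ≤ 1 → 2 * ‖L (lrMul α v β)‖ ≤ hsSq α + hsSq β)
    {ι : Type} [Fintype ι] [DecidableEq ι] (α : Matrix (Fin r) ι ℂ) (v : Matrix ι ι E)
    (β : Matrix ι (Fin r) ℂ) :
    ‖L (lrMul α v β)‖ ^ 2 ≤ hsSq α * hsSq β * gnorm v ^ 2 := by
  have hball : ∀ v : Matrix ι ι E, gnorm v ≤ 1 → ‖L (lrMul α v β)‖ ^ 2 ≤ hsSq α * hsSq β := by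
    intro v hv
    -- Using the discriminant instead of the optimal `t` also covers the cases where `α` or `β`
    -- vanishes.
    have hq : ∀ t : ℝ, 0 ≤ hsSq α * (t * t) + (-2 * ‖L (lrMul α v β)‖) * t + hsSq β := by
      intro t
      have ha := hsSq_nonneg α
      have hb := hsSq_nonneg β
      rcases le_or_gt t 0 with ht | ht
      · nlinarith [norm_nonneg (L (lrMul α v β)), mul_nonneg ha (mul_self_nonneg t)]
      · have h1 := h ι (((√t : ℝ) : ℂ) • α) v ((((√t)⁻¹ : ℝ) : ℂ) • β) hv
        have hs : 0 < √t := Real.sqrt_pos.mpr ht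
        rw [smul_lrMul, lrMul_smul_right, smul_smul, ← Complex.ofReal_mul,
          mul_inv_cancel₀ hs.ne', Complex.ofReal_one, one_smul, hsSq_smul, hsSq_smul,
          Complex.norm_real, Complex.norm_real, norm_inv, inv_pow, Real.norm_of_nonneg hs.le,
          Real.sq_sqrt ht.le] at h1
        have h2 := mul_le_mul_of_nonneg_left h1 ht.le
        rw [mul_add, mul_inv_cancel_left₀ ht.ne'] at h2
        linarith
    have := discrim_le_zero hq
    rw [discrim] at this
    nlinarith
  rcases (gnorm_nonneg v).eq_or_lt with h0 | h0
  · have : lrMul α v β = 0 := by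
      rw [eq_zero_of_gnorm h0.symm]
      exact map_zero (lrMulₗ α β)
    rw [this, map_zero, norm_zero, ← h0]
    simp
  · have hc : ‖((gnorm v : ℝ) : ℂ)‖ = gnorm v := by
      rw [Complex.norm_real, Real.norm_of_nonneg h0.le]
    have h1 := hball ((gnorm v : ℂ)⁻¹ • v) (by
      rw [gnorm_smul, norm_inv, hc, inv_mul_cancel₀ h0.ne'])
    rw [lrMul_smul, map_smul, norm_smul, norm_inv, hc, mul_pow, inv_pow,
      inv_mul_le_iff₀ (by positivity)] at h1
    linarith

/-- Invertibility of `B` and `C` allows `L(v) = f(B⁻¹ v C⁻¹)`, which absorbs the weights in the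
previous domination. -/
theorem exists_hsSq_bounded_factor {f : Matrix (Fin r) (Fin r) E →ₗ[ℂ] ℂ}
    (hf : ∀ v, ‖f v‖ ≤ qnorm r v) {ε : ℝ} (hε : 0 < ε) :
    ∃ (L : Matrix (Fin r) (Fin r) E →ₗ[ℂ] ℂ) (B C : Matrix (Fin r) (Fin r) ℂ),
      hsSq B ≤ 1 + ε ∧ hsSq C ≤ 1 + ε ∧ (∀ v, f v = L (lrMul B v C)) ∧
      ∀ (ι : Type) [Fintype ι] [DecidableEq ι] (α : Matrix (Fin r) ι ℂ) (v : Matrix ι ι E)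
        (β : Matrix ι (Fin r) ℂ), ‖L (lrMul α v β)‖ ^ 2 ≤ hsSq α * hsSq β * gnorm v ^ 2 := by
  obtain ⟨B, C, hB, hC, hB1, hC1, h⟩ := exists_hsSq_factorization hf hε
  rw [isUnit_iff_isUnit_det] at hB hC
  refine ⟨f ∘ₗ lrMulₗ B⁻¹ C⁻¹, B, C, hB1, hC1, fun v => ?_, ?_⟩
  · change f v = f (lrMul B⁻¹ (lrMul B v C) C⁻¹)
    rw [lrMul_lrMul, nonsing_inv_mul B hB, mul_nonsing_inv C hC]
    congr 1
    ext p q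
    simp [lrMul, Matrix.one_apply]
  · intro ι _ _ α v β
    refine norm_sq_le_of_two_mul_le (fun ι _ _ α v β hv => ?_) α v β
    change 2 * ‖f (lrMul B⁻¹ (lrMul α v β) C⁻¹)‖ ≤ _
    rw [lrMul_lrMul]
    refine (h ι (B⁻¹ * α) v (β * C⁻¹) hv).trans (le_of_eq ?_)
    rw [mul_nonsing_inv_cancel_left B α hB, Matrix.mul_assoc, nonsing_inv_mul C hC, Matrix.mul_one]

/-- Pairing the block matrix with two vectors of `ℂ^r ⊗ ℂ^n` is evaluating `L` at `α V β`, with the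
vectors reshaped into matrices; Euclidean norms become Hilbert-Schmidt norms. -/
theorem opNorm_blockMatrix_le {L : Matrix (Fin r) (Fin r) E →ₗ[ℂ] ℂ}
    (hL : ∀ (ι : Type) [Fintype ι] [DecidableEq ι] (α : Matrix (Fin r) ι ℂ) (v : Matrix ι ι E)
        (β : Matrix ι (Fin r) ℂ), ‖L (lrMul α v β)‖ ^ 2 ≤ hsSq α * hsSq β * gnorm v ^ 2)
    (V : Matrix (Fin n) (Fin n) E) :
    opNorm (Matrix.comp _ _ _ _ ℂ (blockMatrix L V)) ≤ qnorm n V := by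
  set Θ := Matrix.comp _ _ _ _ ℂ (blockMatrix L V) with hΘ
  refine opNorm_le (qnorm_nonneg V) fun x => ?_
  set y := Θ *ᵥ x with hy
  -- Testing against `y = Θ x` itself gives `‖y‖⁴ ≤ ‖y‖² ‖x‖² ‖V‖²`.
  have h := hL (Fin n) (of fun p k => star (y (p, k))) V (of fun l q => x (q, l))
  have h1 : L (lrMul (of fun p k => star (y (p, k))) V (of fun l q => x (q, l)))
      = ((∑ i, ‖y i‖ ^ 2 : ℝ) : ℂ) := by
    have h2 : ((∑ i, ‖y i‖ ^ 2 : ℝ) : ℂ) = ∑ i, star (y i) * (Θ *ᵥ x) i := by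
      rw [← hy]
      push_cast
      refine Finset.sum_congr rfl fun i _ => ?_
      rw [Complex.star_def, Complex.conj_mul']
    rw [h2, map_lrMul_eq_sum]
    simp only [mulVec, dotProduct, Fintype.sum_prod_type, Finset.mul_sum]
    refine Finset.sum_congr rfl fun p _ => ?_
    rw [Finset.sum_comm]
    refine Finset.sum_congr rfl fun k _ => Finset.sum_congr rfl fun q _ =>
      Finset.sum_congr rfl fun l _ => ?_
    simp only [of_apply, hΘ, comp_apply, blockMatrix]
    ring
  have h3 : hsSq (of fun p k => star (y (p, k))) = ∑ i, ‖y i‖ ^ 2 := by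
    simp [hsSq, Fintype.sum_prod_type]
  have h4 : hsSq (of fun l q => x (q, l)) = ∑ i, ‖x i‖ ^ 2 := by
    simp [hsSq, Fintype.sum_prod_type_right]
  have h5 : 0 ≤ ∑ i, ‖y i‖ ^ 2 := Finset.sum_nonneg fun _ _ => by positivity
  rw [h1, h3, h4, gnorm_fin, Complex.norm_real, Real.norm_of_nonneg h5, sq, mul_assoc] at h
  rcases h5.eq_or_lt with h0 | h0
  · rw [← h0]
    exact mul_nonneg (sq_nonneg _) (Finset.sum_nonneg fun _ _ => by positivity)
  · rw [mul_comm]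
    exact le_of_mul_le_mul_left h h0

end Factorization

theorem norm_sum_mul_mulVec_sq_le {ι κ : Type*} [Fintype ι] [Fintype κ] [DecidableEq ι]
    [DecidableEq κ] (M : Matrix κ ι ℂ) (y : κ → ℂ) (x : ι → ℂ) :
    ‖∑ i, y i * (M *ᵥ x) i‖ ^ 2 ≤ (∑ i, ‖y i‖ ^ 2) * (opNorm M ^ 2 * ∑ j, ‖x j‖ ^ 2) := by
  have h1 : ‖∑ i, y i * (M *ᵥ x) i‖ ≤ ∑ i, ‖y i‖ * ‖(M *ᵥ x) i‖ :=
    (norm_sum_le _ _).trans (le_of_eq (by simp only [norm_mul]))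
  refine (pow_le_pow_left₀ (norm_nonneg _) h1 2).trans ?_
  refine (Finset.sum_mul_sq_le_sq_mul_sq _ _ _).trans ?_
  exact mul_le_mul_of_nonneg_left (sum_sq_le M x) (Finset.sum_nonneg fun _ _ => by positivity)

/-! ### The isomorphism and its norm estimates -/

section Iota

variable {E : Type u} [AddCommGroup E] [Module ℂ E] {n : ℕ}

/-- The operator `b ↦ ∑ b_{lk} v_{kl}` from `N_n` to `E`. -/
def traceContraction (v : Matrix (Fin n) (Fin n) E) : TraceClass n →ₗ[ℂ] E where
  toFun b := ∑ k, ∑ l, b.toMatrix l k • v k l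
  map_add' b c := by simp [add_smul, Finset.sum_add_distrib]
  map_smul' c b := by simp [Finset.smul_sum, smul_smul]

theorem traceContraction_apply (v : Matrix (Fin n) (Fin n) E) (b : TraceClass n) :
    traceContraction v b = ∑ k, ∑ l, b.toMatrix l k • v k l := rfl

theorem sum_elemTensor (v : Matrix (Fin n) (Fin n) E) :
    v = ∑ i, ∑ j, elemTensor (single i j 1) (v i j) := by
  ext k l
  simp [elemTensor, Matrix.sum_apply, single_apply, ite_and, ite_smul]

variable [QuantumSpace E]

/-- A complete contraction from `E` to `M_r` commutes with the contraction over `N_n`, so it can be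
applied to `v` first; the definition of the norm on `M_r(N_n)` then bounds the scalar matrix `M`,
and `f Y` is a matrix coefficient of `M`. -/
theorem qnorm_amp_traceContraction_le {r : ℕ} (v : Matrix (Fin n) (Fin n) E)
    (x : Matrix (Fin r) (Fin r) (TraceClass n)) :
    qnorm r (amp r (traceContraction v) x) ≤ qnorm n v * qnorm r x := by
  set Y := amp r (traceContraction v) x with hY
  obtain ⟨f, hf, hfY⟩ := exists_norming_functional Y
  have hK : 0 ≤ qnorm n v * qnorm r x := mul_nonneg (qnorm_nonneg v) (qnorm_nonneg x)
  have key : ∀ ε : ℝ, 0 < ε → qnorm r Y ≤ (1 + ε) * (qnorm n v * qnorm r x) := by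
    intro ε hε
    obtain ⟨L, B, C, hB, hC, hfL, hL⟩ := exists_hsSq_bounded_factor hf hε
    -- Here `x` acts as a matrix of functionals on the `M_n`-valued entries of the block matrix.
    set M := pairing (x.map (TraceClass.toDual n)) (blockMatrix L v) with hM
    have hMn : opNorm M ≤ qnorm n v * qnorm r x := by
      have h1 : gnorm M ≤ qnorm r x * qnorm r (blockMatrix L v) := gnorm_pairing_le _ _
      have h2 : opNorm M ≤ gnorm M := by
        have := opNorm_submatrix_le (M.submatrix (Fintype.equivFin (Fin r × Fin r)).symm
          (Fintype.equivFin (Fin r × Fin r)).symm) (Fintype.equivFin (Fin r × Fin r)).injective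
          (Fintype.equivFin (Fin r × Fin r)).injective
        rwa [submatrix_submatrix, Equiv.symm_comp_self, submatrix_id_id] at this
      have h3 : qnorm r (blockMatrix L v) ≤ qnorm n v :=
        (opNorm_submatrix_le _ (Equiv.injective _) (Equiv.injective _)).trans
          (opNorm_blockMatrix_le hL v)
      rw [mul_comm]
      exact h2.trans (h1.trans (mul_le_mul_of_nonneg_left h3 (qnorm_nonneg x)))
    have hentry : ∀ a b p q, L (single p q (Y a b)) = M (p, a) (q, b) := by
      intro a b p q
      have h : ∀ z : E, L (single p q z) = (L ∘ₗ singleLinearMap ℂ p q) z := fun _ => rfl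
      change _ = Matrix.trace ((x a b).toMatrix * blockMatrix L v p q)
      simp only [hY, amp, LinearMap.mapMatrix_apply, map_apply, traceContraction_apply, h,
        map_sum, map_smul, trace, diag_apply, mul_apply, blockMatrix, of_apply]
      rw [Finset.sum_comm]
      rfl
    -- `B` and the transpose of `C` are read as vectors of `ℂ^r ⊗ ℂ^r`, so Cauchy-Schwarz applies.
    have hsum : f Y = ∑ i : Fin r × Fin r, B i.1 i.2 *
        (M *ᵥ fun j : Fin r × Fin r => C j.2 j.1) i := by
      rw [hfL, map_lrMul_eq_sum]
      simp only [mulVec, dotProduct, Fintype.sum_prod_type, Finset.mul_sum]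
      refine Finset.sum_congr rfl fun p _ => ?_
      rw [Finset.sum_comm]
      refine Finset.sum_congr rfl fun k _ => Finset.sum_congr rfl fun q _ =>
        Finset.sum_congr rfl fun l _ => ?_
      rw [hentry]
      ring
    have hsq := norm_sum_mul_mulVec_sq_le M (fun i => B i.1 i.2) (fun j => C j.2 j.1)
    rw [← hsum, hfY, Complex.norm_real, Real.norm_of_nonneg (qnorm_nonneg Y)] at hsq
    have hBs : ∑ i : Fin r × Fin r, ‖B i.1 i.2‖ ^ 2 = hsSq B := by
      simp [hsSq, Fintype.sum_prod_type]
    have hCs : ∑ i : Fin r × Fin r, ‖C i.2 i.1‖ ^ 2 = hsSq C := by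
      simp [hsSq, Fintype.sum_prod_type_right]
    rw [hBs, hCs] at hsq
    refine (sq_le_sq₀ (qnorm_nonneg Y) (by positivity)).mp (hsq.trans ?_)
    have hB0 := hsSq_nonneg B
    have hC0 := hsSq_nonneg C
    have hM0 := opNorm_nonneg M
    calc hsSq B * (opNorm M ^ 2 * hsSq C)
        ≤ (1 + ε) * ((qnorm n v * qnorm r x) ^ 2 * (1 + ε)) := by gcongr
      _ = _ := by ring
  refine le_of_forall_pos_le_add fun δ hδ => ?_
  -- The `+ 1` keeps the denominator positive when `v` or `x` is zero.
  refine (key (δ / (qnorm n v * qnorm r x + 1)) (by positivity)).trans ?_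
  have : δ / (qnorm n v * qnorm r x + 1) * (qnorm n v * qnorm r x) ≤ δ := by
    rw [div_mul_eq_mul_div, div_le_iff₀ (by positivity)]
    nlinarith
  linarith

variable (E n) in
/-- The operator `M_n(E) → CB(N_n, E)`, taking `a ⊗ x` to `b ↦ tr(ab) x`. -/
def traceIota : Matrix (Fin n) (Fin n) E →ₗ[ℂ] CB (TraceClass n) E where
  toFun v := ⟨traceContraction v, qnorm n v, fun _ x => qnorm_amp_traceContraction_le v x⟩
  map_add' v w := by
    refine Subtype.ext (LinearMap.ext fun b => ?_)
    simp [traceContraction_apply, Finset.sum_add_distrib]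
  map_smul' c v := by
    refine Subtype.ext (LinearMap.ext fun b => ?_)
    simp [traceContraction_apply, Finset.smul_sum, smul_smul, mul_comm]

theorem traceIota_apply (v : Matrix (Fin n) (Fin n) E) (b : TraceClass n) :
    (traceIota E n v : TraceClass n →ₗ[ℂ] E) b = ∑ k, ∑ l, b.toMatrix l k • v k l := rfl

/-- The matrix unit `e_{kl}` as a trace-class operator. -/
def TraceClass.unit (k l : Fin n) : TraceClass n := TraceClass.toMatrix.symm (single k l 1)

theorem TraceClass.toMatrix_unit (k l : Fin n) :
    (TraceClass.unit k l).toMatrix = single k l 1 := rfl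

theorem traceIota_unit (v : Matrix (Fin n) (Fin n) E) (k l : Fin n) :
    (traceIota E n v : TraceClass n →ₗ[ℂ] E) (TraceClass.unit l k) = v k l := by
  simp [traceIota_apply, TraceClass.toMatrix_unit, single_apply, ite_and]

theorem TraceClass.sum_unit (b : TraceClass n) :
    b = ∑ k, ∑ l, b.toMatrix l k • TraceClass.unit l k := by
  apply TraceClass.toMatrix.injective
  ext i j
  simp [TraceClass.toMatrix_unit, Matrix.sum_apply, single_apply, ite_and]

theorem traceIota_bijective : Function.Bijective (traceIota E n) := by
  constructor
  · intro v w h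
    ext k l
    rw [← traceIota_unit v k l, h, traceIota_unit]
  · intro T
    refine ⟨of fun k l => (T : TraceClass n →ₗ[ℂ] E) (TraceClass.unit l k),
      Subtype.ext (LinearMap.ext fun b => ?_)⟩
    conv_rhs => rw [TraceClass.sum_unit b]
    simp [traceIota_apply]

/-- Amplification costs nothing: `M_m(M_n(E))` is isometric to `M_n(M_m(E))` by exchanging indices,
so the unamplified estimate is applied with `M_m(E)` in place of `E`. -/
theorem gnorm_pairing_amp_traceIota_le {m r : ℕ}
    (V : Matrix (Fin m) (Fin m) (Matrix (Fin n) (Fin n) E))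
    (x : Matrix (Fin r) (Fin r) (TraceClass n)) :
    gnorm (pairing (amp m (traceIota E n) V) x) ≤ qnorm m V * qnorm r x := by
  let V' : Matrix (Fin n) (Fin n) (Matrix (Fin m) (Fin m) E) :=
    of fun k l => of fun i j => V i j k l
  have h := qnorm_amp_traceContraction_le V' x
  have h1 : qnorm n V' = qnorm m V := by
    refine (qnorm_reindex _ _).trans (Eq.trans ?_ (qnorm_reindex _ _).symm)
    exact gnorm_submatrix_equiv (Matrix.comp _ _ _ _ E V) (Equiv.prodComm (Fin n) (Fin m))
  have h2 : qnorm r (amp r (traceContraction V') x)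
      = gnorm (pairing (amp m (traceIota E n) V) x) := by
    refine (qnorm_reindex _ _).trans (congrArg gnorm ?_)
    ext ⟨p, i⟩ ⟨q, j⟩
    simp [amp, pairing, traceContraction_apply, traceIota_apply, Matrix.sum_apply, V']
  rwa [h1, h2] at h

/-- The matrix in `M_n(N_n)` that corresponds to the identity operator of `M_n`. -/
def TraceClass.idMatrix (n : ℕ) : Matrix (Fin n) (Fin n) (TraceClass n) :=
  of fun p q => TraceClass.unit q p

theorem TraceClass.qnorm_idMatrix_le (n : ℕ) : qnorm n (TraceClass.idMatrix n) ≤ 1 := by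
  have h : toMat ((TraceClass.idMatrix n).map (TraceClass.toDual n)) = LinearMap.id := by
    refine LinearMap.ext fun a => ?_
    ext p q
    change Matrix.trace ((TraceClass.unit q p).toMatrix * a) = a p q
    rw [TraceClass.toMatrix_unit, trace_single_mul, one_smul]
  change cbNorm (toMat ((TraceClass.idMatrix n).map (TraceClass.toDual n))) ≤ 1
  rw [h]
  refine cbNorm_le zero_le_one fun m v => ?_
  rw [one_mul]
  exact le_of_eq rfl

/-- The lower bound needs a single test element: pairing with `TraceClass.idMatrix` lists the
entries of `V` with the two index pairs exchanged. -/
theorem qnorm_amp_traceIota {m : ℕ} (V : Matrix (Fin m) (Fin m) (Matrix (Fin n) (Fin n) E)) :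
    qnorm m (amp m (traceIota E n) V) = qnorm m V := by
  apply le_antisymm
  · exact cbNorm_toMat_le (qnorm_nonneg V) fun _ x => gnorm_pairing_amp_traceIota_le V x
  · have h := gnorm_pairing_le (amp m (traceIota E n) V) (TraceClass.idMatrix n)
    have h1 : gnorm (pairing (amp m (traceIota E n) V) (TraceClass.idMatrix n)) = qnorm m V := by
      refine Eq.trans ?_ (qnorm_reindex _ _).symm
      refine Eq.trans (congrArg gnorm ?_)
        (gnorm_submatrix_equiv (Matrix.comp _ _ _ _ E V) (Equiv.prodComm (Fin n) (Fin m)))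
      ext ⟨p, i⟩ ⟨q, j⟩
      exact traceIota_unit (V i j) p q
    rw [h1] at h
    exact h.trans (mul_le_of_le_one_right (cbNorm_nonneg _) (TraceClass.qnorm_idMatrix_le n))

theorem isCompletelyIsometricIso_traceIota : IsCompletelyIsometricIso (traceIota E n) := by
  refine fun m => ⟨⟨?_, ?_⟩, qnorm_amp_traceIota⟩
  · intro V W h
    ext1 i j
    exact traceIota_bijective.1 (congrFun (congrFun h i) j)
  · intro T
    choose V hV using fun i j => traceIota_bijective.2 (T i j)
    exact ⟨of V, Matrix.ext hV⟩

theorem traceIota_elemTensor (a : Matrix (Fin n) (Fin n) ℂ) (x : E) (b : TraceClass n) :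
    (traceIota E n (elemTensor a x) : TraceClass n →ₗ[ℂ] E) b = trace (a * b.toMatrix) • x := by
  simp [traceIota_apply, elemTensor, trace, mul_apply, Finset.sum_smul, smul_smul, mul_comm]

theorem eq_traceIota {f : Matrix (Fin n) (Fin n) E →ₗ[ℂ] CB (TraceClass n) E}
    (hf : ∀ (a : Matrix (Fin n) (Fin n) ℂ) (x : E) (b : TraceClass n),
      (f (elemTensor a x) : TraceClass n →ₗ[ℂ] E) b = trace (a * b.toMatrix) • x) :
    f = traceIota E n := by
  refine LinearMap.ext fun v => ?_
  rw [sum_elemTensor v]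
  simp only [map_sum]
  refine Finset.sum_congr rfl fun i _ => Finset.sum_congr rfl fun j _ => ?_
  refine Subtype.ext (LinearMap.ext fun b => ?_)
  rw [hf, traceIota_elemTensor]

end Iota

end
end Quantum

universe u

theorem proposition5p4 (n : ℕ) :
    ∃ ι : ∀ (E : Type u) [AddCommGroup E] [Module ℂ E] [Quantum.QuantumSpace E],
        Matrix (Fin n) (Fin n) E →ₗ[ℂ] Quantum.CB (Quantum.TraceClass n) E,
      (∀ (E : Type u) [AddCommGroup E] [Module ℂ E] [Quantum.QuantumSpace E],
        Quantum.IsCompletelyIsometricIso (ι E) ∧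
        (∀ (a : Matrix (Fin n) (Fin n) ℂ) (x : E) (b : Quantum.TraceClass n),
          (ι E (Quantum.elemTensor a x) : Quantum.TraceClass n →ₗ[ℂ] E) b
            = Matrix.trace (a * b.toMatrix) • x) ∧
        (∀ f : Matrix (Fin n) (Fin n) E →ₗ[ℂ] Quantum.CB (Quantum.TraceClass n) E,
          (∀ (a : Matrix (Fin n) (Fin n) ℂ) (x : E) (b : Quantum.TraceClass n),
            (f (Quantum.elemTensor a x) : Quantum.TraceClass n →ₗ[ℂ] E) b
              = Matrix.trace (a * b.toMatrix) • x) → f = ι E)) ∧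
      (∀ (G E : Type u) [AddCommGroup G] [Module ℂ G] [Quantum.QuantumSpace G]
        [AddCommGroup E] [Module ℂ E] [Quantum.QuantumSpace E]
        (φ : Quantum.CB G E) (v : Matrix (Fin n) (Fin n) G),
        ι E (Quantum.amp n (φ : G →ₗ[ℂ] E) v)
          = Quantum.postcomp (Quantum.TraceClass n) φ (ι G v)) := by
  refine ⟨fun E _ _ _ => Quantum.traceIota E n, fun E _ _ _ =>
    ⟨Quantum.isCompletelyIsometricIso_traceIota, Quantum.traceIota_elemTensor,
      fun f hf => Quantum.eq_traceIota hf⟩, fun G E _ _ _ _ _ _ φ v => ?_⟩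
  refine Subtype.ext (LinearMap.ext fun b => ?_)
  simp [Quantum.traceIota_apply, Quantum.amp, Quantum.postcomp]
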